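/- \textbf{Setting.} All graphs are finite and simple. A \emph{subdivided claw} is a tree with exactly one vertex of degree $3$, all other vertices having degree $1$ or $2$; a \emph{path} is a graph isomorphic to $P_k$ for some $k\ge 1$, where $P_k$ is the path on $k$ vertices. A graph is \emph{$H$-free} if it does not contain $H$ as an induced subgraph. For a graph $G$ with at least one vertex and a fugacity $\lambda>0$, the hard-core distribution $\mu_{G,\lambda}$ gives each independent set $I$ of $G$ probability proportional to $\lambda^{|I|}$. Glauber dynamics is the following Markov chain on the independent sets of $G$: from the current state $I$, choose a vertex $v$ uniformly at random; if $v$ has no neighbour in $I$, move to $I\cup\{v\}$ with probability $\lambda/(1+\lambda)$ and to $I\setminus\{v\}$ otherwise; if $v$ has a neighbour in $I$, stay at $I$. With $P^t$ its $t$-step transition probabilities and $d_{\mathrm{TV}}$ total variation distance, its mixing time is $$t_{\mathrm{mix}}(G,\lambda)=\min\Bigl\{t\in\mathbb{N}:\ \max_{I} d_{\mathrm{TV}}\bigl(P^t(I,\cdot),\mu_{G,\lambda}\bigr)\le \tfrac14\Bigr\}.$$ \textbf{Theorem.} Let $H$ be a connected graph that is neither a subdivided claw nor a path. Then there exist a fugacity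 $\lambda>0$ and an infinite family $\mathcal G$ of pairwise distinct $H$-free graphs of maximum degree $3$, each with vertex set $\{0,\dots,n-1\}$ for some $n$ (so that $\mathcal G$ contains graphs with arbitrarily many vertices), such that Glauber dynamics at fugacity $\lambda$ has exponential mixing time on $\mathcal G$: there is a constant $c>0$ with $$t_{\mathrm{mix}}(G,\lambda)\ \ge\ e^{c\,|V(G)|}\qquad\text{for every } G\in\mathcal G.$$ -/

import Mathlib

/-! ### Graphs -/

section Graphs

open Classical in
/-- A subdivided claw: a tree with a single vertex of degree `3`, all of whose other vertices have
degree `1` or `2`. -/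
def IsSubdividedClaw {W : Type*} [Fintype W] (H : SimpleGraph W) : Prop :=
  H.IsTree ∧ ∃ v : W, H.degree v = 3 ∧ ∀ u : W, u ≠ v → H.degree u = 1 ∨ H.degree u = 2

/-- A path: a graph isomorphic to the path graph on `k` vertices for some `k`
(the one-vertex graph is a path). -/
def IsPathGraph {W : Type*} (H : SimpleGraph W) : Prop :=
  ∃ k : ℕ, Nonempty (H ≃g SimpleGraph.pathGraph k)

/-- `G` is `H`-free: it does not contain `H` as an induced subgraph. -/
def IsInducedFree {W V : Type*} (H : SimpleGraph W) (G : SimpleGraph V) : Prop :=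
  ¬ H.IsIndContained G

open Classical in
/-- The maximum degree of `G` is exactly `d`. -/
def HasMaxDegree {V : Type*} [Fintype V] (G : SimpleGraph V) (d : ℕ) : Prop :=
  G.maxDegree = d

/-- Finite graphs, with vertex sets `{0, …, n - 1}`. For each `n` there are only finitely many, so
an infinite set of these contains graphs with arbitrarily many vertices; in particular it is
infinite up to isomorphism. -/
abbrev FiniteGraph : Type := Σ n : ℕ, SimpleGraph (Fin n)

end Graphs

/-! ### The hard-core model and Glauber dynamics -/

section HardCore

variable {V : Type*} [Fintype V]

/-- The independent sets of `G`. -/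
abbrev IndepSets (G : SimpleGraph V) : Type _ := {I : Finset V // G.IsIndepSet (I : Set V)}

open Classical in
noncomputable instance instFintypeIndepSets (G : SimpleGraph V) : Fintype (IndepSets G) :=
  Subtype.fintype _

noncomputable instance instDecidableEqIndepSets (G : SimpleGraph V) :
    DecidableEq (IndepSets G) :=
  Classical.decEq _

/-- The weight `lam ^ |I|` of an independent set. -/
def hardCoreWeight (G : SimpleGraph V) (lam : ℝ) (I : IndepSets G) : ℝ :=
  lam ^ I.1.card

/-- The partition function of the hard-core model. -/
noncomputable def partitionFunction (G : SimpleGraph V) (lam : ℝ) : ℝ :=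
  ∑ I : IndepSets G, hardCoreWeight G lam I

/-- The hard-core distribution. -/
noncomputable def hardCore (G : SimpleGraph V) (lam : ℝ) (I : IndepSets G) : ℝ :=
  hardCoreWeight G lam I / partitionFunction G lam

open Classical in
/-- The probability that an update of `I` at the vertex `v` produces `J`: if `v` has no neighbour
in `I`, the new state is `I ∪ {v}` with probability `lam / (1 + lam)` and `I \ {v}` with the
remaining probability; otherwise the new state is `I`. -/
noncomputable def siteUpdate (G : SimpleGraph V) (lam : ℝ) (v : V) (I J : IndepSets G) : ℝ :=
  if ∀ u ∈ I.1, ¬ G.Adj v u then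
    lam / (1 + lam) * (if J.1 = insert v I.1 then 1 else 0) +
      (1 - lam / (1 + lam)) * (if J.1 = I.1.erase v then 1 else 0)
  else if J = I then 1 else 0

/-- The transition matrix of Glauber dynamics on a graph with at least one vertex: a vertex is
chosen uniformly at random and updated. -/
noncomputable def glauber (G : SimpleGraph V) (lam : ℝ) :
    Matrix (IndepSets G) (IndepSets G) ℝ :=
  Matrix.of fun I J => (∑ v : V, siteUpdate G lam v I J) / Fintype.card V

/-- Total variation distance, one half of the `ℓ₁` distance. -/
noncomputable def tvDist {S : Type*} [Fintype S] (p q : S → ℝ) : ℝ :=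
  (∑ s, |p s - q s|) / 2

/-- The distance `d(t)` from stationarity after `t` steps, for the worst initial state. -/
noncomputable def distToStationarity (G : SimpleGraph V) (lam : ℝ) (t : ℕ) : ℝ :=
  ⨆ I : IndepSets G, tvDist (fun J => (glauber G lam ^ t) I J) (hardCore G lam)

/-- The mixing time `min {t : d(t) ≤ 1/4}`. (If there were no such `t`, the value would be `0`, so
a positive lower bound on it includes the claim that the chain does mix.) -/
noncomputable def mixingTime (G : SimpleGraph V) (lam : ℝ) : ℕ :=
  sInf {t : ℕ | distToStationarity G lam t ≤ 1 / 4}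

/-- Glauber dynamics at fugacity `lam` has exponential mixing time on the family `𝒢`: for some
constant `c > 0`, the mixing time is at least `exp (c n)` for every graph in `𝒢`, where `n` is its
number of vertices. -/
def HasExponentialMixingTime (lam : ℝ) (𝒢 : Set FiniteGraph) : Prop :=
  ∃ c : ℝ, 0 < c ∧ ∀ G ∈ 𝒢, Real.exp (c * (G.1 : ℝ)) ≤ (mixingTime G.2 lam : ℝ)

end HardCore

/-! The hard-core model on the bipartite double cover of an expanding digraph has two competing
maximum independent sets, one for each side. Each node `e` gives a matching edge `(e, true)`–`(e,
false)`, so an independent set falls short of `|D|`, the number of nodes, by its number of vacant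
nodes. Occupation of the `true` side propagates along an arrow unless its head is vacant
(`occupied_of_arrow`). Expansion, obtained by counting pairs of permutations
(`exists_expanding_perms`), makes a balanced mixture of the two sides cost at least `w` vacancies,
with `w` linear in the number of vertices for fixed `l` (`network_hasBottleneck`). For large
constant fugacity this loss outweighs the at most `2 ^ n` states in the bottleneck, and a
conductance bound gives exponential mixing time (`bottleneck_le`, `pow_le_mixingTime`).

To exclude `H`, the arrows of the expander are stretched into paths of length `l > |H|`. The result
maps to a cycle of length `4 * l`, with all branching at levels `0` and `2 * l - 1`. Walks without
backtracking move along this cycle at constant speed between branchings, so a connected piece with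
fewer than `l` vertices contains no cycle and at most one branching vertex. With maximum degree `3`,
it is a subdivided claw or a path (`IsLevelling.isSubdividedClaw_or_isPathGraph`). -/

/-! ### Convergence and conductance for finite Markov chains. -/

section FiniteMarkovChains

/-- A stochastic matrix all of whose entries are at least `ε` contracts the `ℓ₁` norm of vectors of
total mass zero. -/
theorem sum_abs_mul_le {S : Type*} [Fintype S] {Q : Matrix S S ℝ} {μ : S → ℝ} {ε : ℝ} (hQ1 : ∀ I, ∑ J, Q I J = 1)
    (hμ1 : ∑ I, μ I = 1) (hQ : ∀ I J, ε * μ J ≤ Q I J) (ν : S → ℝ) (hν : ∑ I, ν I = 0) :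
    ∑ J, |∑ I, ν I * Q I J| ≤ (1 - ε) * ∑ I, |ν I| := by
  have h1 : ∀ J, |∑ I, ν I * Q I J| ≤ ∑ I, |ν I| * (Q I J - ε * μ J) := fun J => by
    -- Doeblin's argument: as `ν` has total mass zero, the common part `ε * μ J` of all rows may be
    -- subtracted.
    have : ∑ I, ν I * Q I J = ∑ I, ν I * (Q I J - ε * μ J) := by
      simp_rw [mul_sub, Finset.sum_sub_distrib, ← Finset.sum_mul, hν, zero_mul, sub_zero]
    rw [this]
    refine (Finset.abs_sum_le_sum_abs _ _).trans (Finset.sum_le_sum fun I _ => ?_)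
    rw [abs_mul, abs_of_nonneg (sub_nonneg.2 (hQ I J))]
  refine (Finset.sum_le_sum fun J _ => h1 J).trans (le_of_eq ?_)
  rw [Finset.sum_comm]
  simp_rw [← Finset.mul_sum, Finset.sum_sub_distrib, ← Finset.mul_sum, hQ1, hμ1]
  rw [← Finset.sum_mul]
  ring

variable {S : Type*} [Fintype S] [DecidableEq S]

theorem matrix_pow_nonneg {P : Matrix S S ℝ} (h : ∀ I J, 0 ≤ P I J) (t : ℕ) (I J : S) :
    0 ≤ (P ^ t) I J := by
  induction t generalizing I J with
  | zero => rw [pow_zero, Matrix.one_apply]; split_ifs <;> norm_num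
  | succ t ih =>
    rw [pow_succ, Matrix.mul_apply]
    exact Finset.sum_nonneg fun K _ => mul_nonneg (ih _ _) (h _ _)

theorem matrix_pow_row_sum {P : Matrix S S ℝ} (h : ∀ I, ∑ J, P I J = 1) (t : ℕ) (I : S) :
    ∑ J, (P ^ t) I J = 1 := by
  induction t generalizing I with
  | zero => simp [Matrix.one_apply]
  | succ t ih =>
    simp_rw [pow_succ, Matrix.mul_apply]
    rw [Finset.sum_comm]
    simp_rw [← Finset.mul_sum, h, mul_one, ih]

theorem matrix_pow_stationary {P : Matrix S S ℝ} {μ : S → ℝ}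
    (h : ∀ J, ∑ I, μ I * P I J = μ J) (t : ℕ) (J : S) :
    ∑ I, μ I * (P ^ t) I J = μ J := by
  induction t generalizing J with
  | zero => simp [Matrix.one_apply]
  | succ t ih =>
    simp_rw [pow_succ, Matrix.mul_apply, Finset.mul_sum]
    rw [Finset.sum_comm]
    simp_rw [← mul_assoc, ← Finset.sum_mul, ih, h]

/-- For distributions of the same total mass, the mass of an event differs by at most the total
variation distance. -/
theorem sum_sub_sum_le_tvDist {p q : S → ℝ} (h : ∑ s, p s = ∑ s, q s) (B : Finset S) :
    ∑ s ∈ B, q s - ∑ s ∈ B, p s ≤ tvDist p q := by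
  have h1 : ∑ s ∈ B, q s - ∑ s ∈ B, p s ≤ ∑ s ∈ B, |p s - q s| := by
    rw [← Finset.sum_sub_distrib]
    exact Finset.sum_le_sum fun s _ => by rw [abs_sub_comm]; exact le_abs_self _
  have h2 : ∑ s ∈ Bᶜ, p s - ∑ s ∈ Bᶜ, q s ≤ ∑ s ∈ Bᶜ, |p s - q s| := by
    rw [← Finset.sum_sub_distrib]
    exact Finset.sum_le_sum fun s _ => le_abs_self _
  have h3 := Finset.sum_add_sum_compl B p
  have h4 := Finset.sum_add_sum_compl B q
  have h5 := Finset.sum_add_sum_compl B (fun s => |p s - q s|)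
  unfold tvDist
  linarith

/-- Starting from the stationary distribution restricted to `A`, the mass outside `A` grows by at
most the ergodic flow out of `A` in each step. -/
theorem escape_mass_le {P : Matrix S S ℝ} {μ : S → ℝ} (hP0 : ∀ I J, 0 ≤ P I J)
    (hP1 : ∀ I, ∑ J, P I J = 1) (hμ0 : ∀ I, 0 ≤ μ I)
    (hstat : ∀ J, ∑ I, μ I * P I J = μ J) (A : Finset S) (t : ℕ) :
    ∑ J ∈ Aᶜ, ∑ I ∈ A, μ I * (P ^ t) I J ≤ t * ∑ I ∈ A, ∑ J ∈ Aᶜ, μ I * P I J := by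
  induction t with
  | zero =>
    refine le_of_eq ?_
    rw [Nat.cast_zero, zero_mul]
    refine Finset.sum_eq_zero fun J hJ => Finset.sum_eq_zero fun I hI => ?_
    rw [pow_zero, Matrix.one_apply_ne, mul_zero]
    rintro rfl
    exact Finset.mem_compl.1 hJ hI
  | succ t ih =>
    set ν : S → ℝ := fun K => ∑ I ∈ A, μ I * (P ^ t) I K with hν
    have hν0 : ∀ K, 0 ≤ ν K := fun K =>
      Finset.sum_nonneg fun I _ => mul_nonneg (hμ0 I) (matrix_pow_nonneg hP0 _ _ _)
    have hνμ : ∀ K, ν K ≤ μ K := fun K => by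
      rw [← matrix_pow_stationary hstat t K]
      exact Finset.sum_le_univ_sum_of_nonneg
        fun I => mul_nonneg (hμ0 I) (matrix_pow_nonneg hP0 _ _ _)
    have key : ∑ J ∈ Aᶜ, ∑ I ∈ A, μ I * (P ^ (t + 1)) I J
        = ∑ K, ∑ J ∈ Aᶜ, ν K * P K J := by
      rw [Finset.sum_comm (s := Finset.univ)]
      refine Finset.sum_congr rfl fun J _ => ?_
      simp_rw [hν, pow_succ, Matrix.mul_apply, Finset.mul_sum, Finset.sum_mul]
      rw [Finset.sum_comm]
      simp_rw [mul_assoc]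
    -- Split by the state `K` before the last step: from `A` the bound `ν ≤ μ` gives one more unit
    -- of flow, and outside `A` the mass had already escaped.
    rw [key, ← Finset.sum_add_sum_compl A]
    have h1 : ∑ K ∈ A, ∑ J ∈ Aᶜ, ν K * P K J ≤ ∑ K ∈ A, ∑ J ∈ Aᶜ, μ K * P K J :=
      Finset.sum_le_sum fun K _ => Finset.sum_le_sum fun J _ =>
        mul_le_mul_of_nonneg_right (hνμ K) (hP0 _ _)
    have h2 : ∑ K ∈ Aᶜ, ∑ J ∈ Aᶜ, ν K * P K J ≤ ∑ K ∈ Aᶜ, ν K := by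
      refine Finset.sum_le_sum fun K _ => ?_
      rw [← Finset.mul_sum]
      refine mul_le_of_le_one_right (hν0 K) ?_
      rw [← hP1 K]
      exact Finset.sum_le_univ_sum_of_nonneg fun J => hP0 _ _
    push_cast
    linarith

/-- Once the chain has mixed, every start gives `Aᶜ` mass at least `1/2 - 1/4`. So a quarter of the
mass of `A` has escaped, at a rate bounded by the flow. -/
theorem bottleneck_le {P : Matrix S S ℝ} {μ : S → ℝ} (hP0 : ∀ I J, 0 ≤ P I J)
    (hP1 : ∀ I, ∑ J, P I J = 1) (hμ0 : ∀ I, 0 ≤ μ I) (hμ1 : ∑ I, μ I = 1)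
    (hstat : ∀ J, ∑ I, μ I * P I J = μ J) (A : Finset S) (hA : ∑ I ∈ A, μ I ≤ 1 / 2) (t : ℕ)
    (ht : ∀ I, tvDist (fun J => (P ^ t) I J) μ ≤ 1 / 4) :
    ∑ I ∈ A, μ I ≤ 4 * (t * ∑ I ∈ A, ∑ J ∈ Aᶜ, μ I * P I J) := by
  have h1 := escape_mass_le hP0 hP1 hμ0 hstat A t
  have h2 : ∑ I ∈ A, μ I * (1 / 4) ≤ ∑ J ∈ Aᶜ, ∑ I ∈ A, μ I * (P ^ t) I J := by
    rw [Finset.sum_comm]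
    refine Finset.sum_le_sum fun I _ => ?_
    rw [← Finset.mul_sum]
    refine mul_le_mul_of_nonneg_left ?_ (hμ0 I)
    have h3 := sum_sub_sum_le_tvDist (p := fun J => (P ^ t) I J) (q := μ)
      (by rw [matrix_pow_row_sum hP1, hμ1]) Aᶜ
    have h4 := Finset.sum_add_sum_compl A μ
    have h5 := ht I
    linarith
  rw [← Finset.sum_mul] at h2
  linarith

/-- Every `n` steps contract the distance to `μ` by a factor `1 - ε`, where `ε` is the least entry
of `P ^ n`. This is needed because the infimum defining the mixing time would be `0` over an empty
set. -/
theorem exists_tvDist_le [Nonempty S] {P : Matrix S S ℝ} {μ : S → ℝ}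
    (hP1 : ∀ I, ∑ J, P I J = 1) (hμ0 : ∀ I, 0 ≤ μ I) (hμ1 : ∑ I, μ I = 1)
    (hstat : ∀ J, ∑ I, μ I * P I J = μ J) {n : ℕ} (hpos : ∀ I J, 0 < (P ^ n) I J) :
    ∃ t : ℕ, ∀ I, tvDist (fun J => (P ^ t) I J) μ ≤ 1 / 4 := by
  obtain ⟨⟨I₀, J₀⟩, hmin⟩ := Finite.exists_min (fun x : S × S => (P ^ n) x.1 x.2)
  set ε := (P ^ n) I₀ J₀ with hε
  have hε0 : 0 < ε := hpos _ _
  have hμle : ∀ J, μ J ≤ 1 := fun J => by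
    rw [← hμ1]; exact Finset.single_le_sum (fun I _ => hμ0 I) (Finset.mem_univ J)
  have hQ : ∀ I J, ε * μ J ≤ (P ^ n) I J := fun I J =>
    (mul_le_of_le_one_right hε0.le (hμle J)).trans (hmin (I, J))
  have hε1 : 0 ≤ 1 - ε := by
    have := Finset.sum_le_sum (s := Finset.univ) fun J _ => hQ I₀ J
    rw [← Finset.mul_sum, hμ1, matrix_pow_row_sum hP1] at this
    linarith
  have hdec : ∀ k : ℕ, ∀ I, ∑ J, |(P ^ (n * k)) I J - μ J| ≤ (1 - ε) ^ k * 2 := by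
    intro k I
    have hsum : ∀ t, ∑ J, ((P ^ t) I J - μ J) = 0 := fun t => by
      rw [Finset.sum_sub_distrib, matrix_pow_row_sum hP1, hμ1, sub_self]
    induction k with
    | zero =>
      rw [pow_zero, one_mul, mul_zero, pow_zero]
      refine (Finset.sum_le_sum fun J _ => abs_sub _ _).trans ?_
      rw [Finset.sum_add_distrib]
      simp only [abs_of_nonneg (hμ0 _), hμ1, Matrix.one_apply]
      simp [apply_ite]
      norm_num
    | succ k ih =>
      have h1 := sum_abs_mul_le (matrix_pow_row_sum hP1 n) hμ1 hQ _ (hsum (n * k))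
      have h2 : ∀ J, ∑ K, ((P ^ (n * k)) I K - μ K) * (P ^ n) K J
          = (P ^ (n * (k + 1))) I J - μ J := fun J => by
        simp_rw [sub_mul]
        rw [Finset.sum_sub_distrib, matrix_pow_stationary hstat, mul_add, mul_one, pow_add,
          Matrix.mul_apply]
      simp_rw [h2] at h1
      rw [pow_succ', mul_assoc]
      exact h1.trans (mul_le_mul_of_nonneg_left ih hε1)
  obtain ⟨k, hk⟩ := exists_pow_lt_of_lt_one (show (0 : ℝ) < 1 / 4 by norm_num)
    (show 1 - ε < 1 by linarith)
  refine ⟨n * k, fun I => ?_⟩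
  have := hdec k I
  unfold tvDist
  linarith

end FiniteMarkovChains

/-! ### Reversibility, ergodicity and bottlenecks of Glauber dynamics. -/

section Glauber

variable {V : Type*} {G : SimpleGraph V} {lam : ℝ}

theorem hardCoreWeight_pos (hl : 0 < lam) (I : IndepSets G) : 0 < hardCoreWeight G lam I :=
  pow_pos hl _

open Classical in
theorem isIndepSet_insert {I : IndepSets G} {v : V} (h : ∀ u ∈ I.1, ¬ G.Adj v u) :
    G.IsIndepSet ((insert v I.1 : Finset V) : Set V) := by
  intro a ha b hb hab
  simp only [Finset.coe_insert, Set.mem_insert_iff, Finset.mem_coe] at ha hb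
  rcases ha with rfl | ha <;> rcases hb with rfl | hb
  · exact absurd rfl hab
  · exact h _ hb
  · exact fun hadj => h _ ha hadj.symm
  · exact I.2 ha hb hab

open Classical in
theorem isIndepSet_erase (I : IndepSets G) (v : V) :
    G.IsIndepSet ((I.1.erase v : Finset V) : Set V) :=
  I.2.mono (by exact_mod_cast Finset.erase_subset v I.1)

variable [Fintype V]

/-- The empty independent set. -/
def emptyIndepSet (G : SimpleGraph V) : IndepSets G := ⟨∅, by simp [SimpleGraph.IsIndepSet]⟩

instance instNonemptyIndepSets (G : SimpleGraph V) : Nonempty (IndepSets G) := ⟨emptyIndepSet G⟩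

theorem partitionFunction_pos (hl : 0 < lam) : 0 < partitionFunction G lam :=
  Finset.sum_pos (fun I _ => hardCoreWeight_pos hl I) Finset.univ_nonempty

theorem hardCore_nonneg (hl : 0 < lam) (I : IndepSets G) : 0 ≤ hardCore G lam I :=
  div_nonneg (hardCoreWeight_pos hl I).le (partitionFunction_pos hl).le

theorem sum_hardCore (hl : 0 < lam) : ∑ I, hardCore G lam I = 1 := by
  simp_rw [hardCore]
  rw [← Finset.sum_div]
  exact div_self (partitionFunction_pos hl).ne'

theorem siteUpdate_nonneg (hl : 0 < lam) (v : V) (I J : IndepSets G) :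
    0 ≤ siteUpdate G lam v I J := by
  have h1 : 0 ≤ lam / (1 + lam) := by positivity
  have h2 : 0 ≤ 1 - lam / (1 + lam) := by
    rw [sub_nonneg, div_le_one (by linarith)]; linarith
  unfold siteUpdate
  split_ifs <;> simp [h1, h2]

theorem sum_siteUpdate (v : V) (I : IndepSets G) : ∑ J, siteUpdate G lam v I J = 1 := by
  classical
  by_cases h : ∀ u ∈ I.1, ¬ G.Adj v u
  · have h1 : ∀ J : IndepSets G, siteUpdate G lam v I J =
        lam / (1 + lam) * (if J = ⟨insert v I.1, isIndepSet_insert h⟩ then 1 else 0) +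
        (1 - lam / (1 + lam)) * (if J = ⟨I.1.erase v, isIndepSet_erase I v⟩ then 1 else 0) := by
      intro J
      rw [siteUpdate, if_pos h]
      simp only [Subtype.ext_iff]
    simp_rw [h1, Finset.sum_add_distrib, ← Finset.mul_sum]
    simp
  · simp [siteUpdate, h]

/-- Distinct states communicate only by adding or removing `v`; both directions then have weight
`lam ^ (|I| + 1) / (1 + lam)`, with `I` the smaller set. -/
theorem siteUpdate_reversible (hl : 0 < lam) (v : V) (I J : IndepSets G) :
    hardCoreWeight G lam I * siteUpdate G lam v I J
      = hardCoreWeight G lam J * siteUpdate G lam v J I := by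
  classical
  by_cases hIJ : I = J
  · rw [hIJ]
  have hJI : J ≠ I := fun h => hIJ h.symm
  have hv : 1 - lam / (1 + lam) = 1 / (1 + lam) := by field_simp; ring
  have key : ∀ I J : IndepSets G, I ≠ J → (∀ u ∈ I.1, ¬ G.Adj v u) → J.1 = insert v I.1 →
      hardCoreWeight G lam I * siteUpdate G lam v I J
        = hardCoreWeight G lam J * siteUpdate G lam v J I := by
    intro I J hIJ hI hins
    have hvI : v ∉ I.1 := fun hvI => hIJ (Subtype.ext (by rw [hins, Finset.insert_eq_of_mem hvI]))
    have hJ : ∀ u ∈ J.1, ¬ G.Adj v u := by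
      intro u hu
      rw [hins, Finset.mem_insert] at hu
      rcases hu with rfl | hu
      · exact G.loopless.irrefl _
      · exact hI u hu
    have e1 : J.1 ≠ I.1.erase v := by
      intro h
      have : v ∈ J.1 := by rw [hins]; exact Finset.mem_insert_self _ _
      rw [h] at this
      exact Finset.notMem_erase _ _ this
    have e2 : I.1 ≠ insert v J.1 := fun h => hvI (h ▸ Finset.mem_insert_self _ _)
    have e3 : I.1 = J.1.erase v := by rw [hins, Finset.erase_insert hvI]
    have e4 : J.1.card = I.1.card + 1 := by rw [hins, Finset.card_insert_of_notMem hvI]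
    have c1 : siteUpdate G lam v I J = lam / (1 + lam) := by
      rw [siteUpdate, if_pos hI, if_pos (by convert hins), if_neg (by convert e1)]; ring
    have c2 : siteUpdate G lam v J I = 1 / (1 + lam) := by
      rw [siteUpdate, if_pos hJ, if_neg (by convert e2), if_pos (by convert e3), ← hv]; ring
    rw [c1, c2, hardCoreWeight, hardCoreWeight, e4, pow_succ]
    ring
  by_cases h1 : (∀ u ∈ I.1, ¬ G.Adj v u) ∧ J.1 = insert v I.1
  · exact key I J hIJ h1.1 h1.2
  by_cases h2 : (∀ u ∈ J.1, ¬ G.Adj v u) ∧ I.1 = insert v J.1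
  · exact (key J I hJI h2.1 h2.2).symm
  have zero : ∀ I J : IndepSets G, I ≠ J →
      ¬ ((∀ u ∈ I.1, ¬ G.Adj v u) ∧ J.1 = insert v I.1) →
      ¬ ((∀ u ∈ J.1, ¬ G.Adj v u) ∧ I.1 = insert v J.1) → siteUpdate G lam v I J = 0 := by
    intro I J hIJ h1 h2
    by_cases hI : ∀ u ∈ I.1, ¬ G.Adj v u
    · have e1 : J.1 ≠ insert v I.1 := fun h => h1 ⟨hI, h⟩
      have e2 : J.1 ≠ I.1.erase v := by
        intro h
        refine h2 ⟨fun u hu => hI u (Finset.mem_of_mem_erase (h ▸ hu)), ?_⟩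
        by_cases hv : v ∈ I.1
        · rw [h, Finset.insert_erase hv]
        · exact absurd (Subtype.ext (by rw [h, Finset.erase_eq_of_notMem hv])) hIJ
      rw [siteUpdate, if_pos hI, if_neg (by convert e1), if_neg (by convert e2)]
      ring
    · rw [siteUpdate, if_neg hI, if_neg (Ne.symm hIJ)]
  rw [zero I J hIJ h1 h2, zero J I hJI h2 h1, mul_zero, mul_zero]

theorem glauber_nonneg (hl : 0 < lam) (I J : IndepSets G) : 0 ≤ glauber G lam I J :=
  div_nonneg (Finset.sum_nonneg fun v _ => siteUpdate_nonneg hl v I J) (Nat.cast_nonneg _)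

theorem glauber_row_sum [Nonempty V] (I : IndepSets G) : ∑ J, glauber G lam I J = 1 := by
  simp only [glauber, Matrix.of_apply]
  rw [← Finset.sum_div, Finset.sum_comm]
  simp_rw [sum_siteUpdate]
  simp

theorem glauber_stationary [Nonempty V] (hl : 0 < lam) (J : IndepSets G) :
    ∑ I, hardCore G lam I * glauber G lam I J = hardCore G lam J := by
  have h : ∀ I, hardCore G lam I * glauber G lam I J = hardCore G lam J * glauber G lam J I := by
    intro I
    simp only [glauber, Matrix.of_apply, hardCore, div_mul_div_comm, Finset.mul_sum,
      siteUpdate_reversible hl _ I J]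
  simp_rw [h]
  rw [← Finset.mul_sum, glauber_row_sum, mul_one]

theorem glauber_pos_of_siteUpdate_pos (hl : 0 < lam) {v : V} {I J : IndepSets G}
    (h : 0 < siteUpdate G lam v I J) : 0 < glauber G lam I J := by
  have : Nonempty V := ⟨v⟩
  exact div_pos (Finset.sum_pos' (fun v _ => siteUpdate_nonneg hl v I J) ⟨v, Finset.mem_univ v, h⟩)
    (by exact_mod_cast Fintype.card_pos)

open Classical in
theorem siteUpdate_pos (hl : 0 < lam) {v : V} {I J : IndepSets G}
    (h : ∀ u ∈ I.1, ¬ G.Adj v u) (hJ : J.1 = insert v I.1 ∨ J.1 = I.1.erase v) :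
    0 < siteUpdate G lam v I J := by
  have h1 : 0 < lam / (1 + lam) := by positivity
  have h2 : 0 < 1 - lam / (1 + lam) := by
    rw [sub_pos, div_lt_one (by linarith)]; linarith
  rw [siteUpdate, if_pos h]
  rcases hJ with hJ | hJ
  · rw [if_pos hJ]
    split_ifs <;> linarith
  · rw [if_pos hJ]
    split_ifs <;> linarith

theorem glauber_self_pos [Nonempty V] (hl : 0 < lam) (I : IndepSets G) :
    0 < glauber G lam I I := by
  classical
  obtain ⟨v⟩ := ‹Nonempty V›
  refine glauber_pos_of_siteUpdate_pos hl (v := v) ?_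
  by_cases h : ∀ u ∈ I.1, ¬ G.Adj v u
  · refine siteUpdate_pos hl h ?_
    by_cases hv : v ∈ I.1
    · exact Or.inl (by rw [Finset.insert_eq_of_mem hv])
    · exact Or.inr (by rw [Finset.erase_eq_of_notMem hv])
  · rw [siteUpdate, if_neg h, if_pos rfl]
    exact one_pos

theorem matrix_pow_succ_pos {S : Type*} [Fintype S] [DecidableEq S] {P : Matrix S S ℝ}
    (hP : ∀ I J, 0 ≤ P I J) {s t : ℕ} {I J K : S} (h1 : 0 < (P ^ s) I J) (h2 : 0 < (P ^ t) J K) :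
    0 < (P ^ (s + t)) I K := by
  rw [pow_add, Matrix.mul_apply]
  exact Finset.sum_pos' (fun L _ => mul_nonneg (matrix_pow_nonneg hP _ _ _)
    (matrix_pow_nonneg hP _ _ _)) ⟨J, Finset.mem_univ J, mul_pos h1 h2⟩

/-- Vertices can be removed or added one at a time, and holding at the empty set pads the number of
steps to exactly `k`. Any two states thus communicate through the empty set in a common number of
steps. -/
theorem glauber_pow_empty_pos [Nonempty V] (hl : 0 < lam) (k : ℕ) (I : IndepSets G)
    (hI : I.1.card ≤ k) : 0 < (glauber G lam ^ k) I (emptyIndepSet G) ∧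
      0 < (glauber G lam ^ k) (emptyIndepSet G) I := by
  classical
  induction k generalizing I with
  | zero =>
    have : I = emptyIndepSet G := Subtype.ext (Finset.card_eq_zero.1 (Nat.le_zero.1 hI))
    subst this
    simp
  | succ k ih =>
    suffices h : ∃ J : IndepSets G, J.1.card ≤ k ∧ 0 < glauber G lam I J ∧ 0 < glauber G lam J I by
      obtain ⟨J, hJ, h1, h2⟩ := h
      rw [← pow_one (glauber G lam)] at h1 h2
      refine ⟨?_, matrix_pow_succ_pos (glauber_nonneg hl) (ih J hJ).2 h2⟩
      rw [add_comm k 1]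
      exact matrix_pow_succ_pos (glauber_nonneg hl) h1 (ih J hJ).1
    rcases I.1.eq_empty_or_nonempty with h0 | ⟨v, hv⟩
    · exact ⟨I, by simp [h0], glauber_self_pos hl I, glauber_self_pos hl I⟩
    · have hI' : ∀ u ∈ I.1, ¬ G.Adj v u := fun u hu hadj => I.2 hv hu hadj.ne hadj
      refine ⟨⟨I.1.erase v, isIndepSet_erase I v⟩, ?_, ?_, ?_⟩
      · simp only [Finset.card_erase_of_mem hv]; omega
      · exact glauber_pos_of_siteUpdate_pos hl (siteUpdate_pos hl hI' (Or.inr rfl))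
      · refine glauber_pos_of_siteUpdate_pos hl (v := v) (siteUpdate_pos hl ?_ (Or.inl ?_))
        · exact fun u hu => hI' u (Finset.mem_of_mem_erase hu)
        · simp [Finset.insert_erase hv]

theorem exists_distToStationarity_le [Nonempty V] (hl : 0 < lam) :
    ∃ t, distToStationarity G lam t ≤ 1 / 4 := by
  obtain ⟨t, ht⟩ := exists_tvDist_le (n := Fintype.card V + Fintype.card V)
    (glauber_row_sum (G := G) (lam := lam))
    (hardCore_nonneg hl) (sum_hardCore hl) (glauber_stationary hl) fun I J =>
      matrix_pow_succ_pos (glauber_nonneg hl)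
        (glauber_pow_empty_pos hl _ I (Finset.card_le_univ _)).1
        (glauber_pow_empty_pos hl _ J (Finset.card_le_univ _)).2
  exact ⟨t, ciSup_le ht⟩

theorem tvDist_mixingTime_le [Nonempty V] (hl : 0 < lam) (I : IndepSets G) :
    tvDist (fun J => (glauber G lam ^ mixingTime G lam) I J) (hardCore G lam) ≤ 1 / 4 := by
  have h : distToStationarity G lam (mixingTime G lam) ≤ 1 / 4 :=
    Nat.sInf_mem (s := {t | distToStationarity G lam t ≤ 1 / 4}) (exists_distToStationarity_le hl)
  exact (le_ciSup (f := fun I => tvDist (fun J => (glauber G lam ^ mixingTime G lam) I J)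
    (hardCore G lam)) (Set.finite_range _).bddAbove I).trans h

/-- The number of occupied vertices in a given set. -/
noncomputable def occupancy (U : Set V) (I : IndepSets G) : ℕ := ((I.1 : Set V) ∩ U).ncard

theorem occupancy_le_succ (U : Set V) {I J : IndepSets G} {v : V}
    (h : (I.1 : Set V) ⊆ insert v (J.1 : Set V)) : occupancy U I ≤ occupancy U J + 1 := by
  unfold occupancy
  refine (Set.ncard_le_ncard ?_ (Set.toFinite _)).trans (Set.ncard_insert_le v _)
  rintro x ⟨hx, hU⟩
  rcases h hx with rfl | h
  · exact Set.mem_insert _ _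
  · exact Set.mem_insert_of_mem _ ⟨h, hU⟩

theorem occupancy_le_succ_of_glauber_ne_zero (U : Set V) {I J : IndepSets G}
    (h : glauber G lam I J ≠ 0) :
    occupancy U I ≤ occupancy U J + 1 ∧ occupancy U J ≤ occupancy U I + 1 := by
  classical
  have : ∃ v, siteUpdate G lam v I J ≠ 0 := by
    by_contra! h0
    exact h (by simp [glauber, h0])
  obtain ⟨v, hv⟩ := this
  suffices h : (I.1 : Set V) ⊆ insert v (J.1 : Set V) ∧ (J.1 : Set V) ⊆ insert v (I.1 : Set V) from
    ⟨occupancy_le_succ U h.1, occupancy_le_succ U h.2⟩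
  rw [siteUpdate] at hv
  split_ifs at hv with h1 h2 h3 h3 h4
  · rw [h2]; simp
  · rw [h2]; simp
  · rw [h3]
    simp only [Finset.coe_erase, Set.insert_sdiff_singleton]
    exact ⟨Set.subset_insert _ _, Set.sdiff_subset.trans (Set.subset_insert _ _)⟩
  · simp at hv
  · rw [h4]; exact ⟨Set.subset_insert _ _, Set.subset_insert _ _⟩
  · exact absurd rfl hv

theorem hardCore_le (hl : 1 ≤ lam) {I : IndepSets G} {M : ℕ} (hI : I.1.card ≤ M) :
    hardCore G lam I ≤ lam ^ M / partitionFunction G lam :=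
  div_le_div_of_nonneg_right (pow_le_pow_right₀ hl hI)
    (partitionFunction_pos (zero_lt_one.trans_le hl)).le

/-- A lower bound for the mixing time when one side `A` of a cut has mass at most `1/2`, contains a
large independent set, and is left only through small independent sets. -/
theorem pow_le_mixingTime_of_cut [Nonempty V] (hl : 1 ≤ lam) (A : Finset (IndepSets G)) {N w : ℕ}
    (hA : ∑ I ∈ A, hardCore G lam I ≤ 1 / 2) {I₀ : IndepSets G} (hI₀ : I₀ ∈ A)
    (hN : I₀.1.card = N)
    (hb : ∀ I ∈ A, ∀ J ∈ Aᶜ, glauber G lam I J ≠ 0 → I.1.card + w ≤ N) :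
    lam ^ w ≤ 4 * (mixingTime G lam * 2 ^ Fintype.card V) := by
  have hl0 : 0 < lam := zero_lt_one.trans_le hl
  have hZ := partitionFunction_pos (G := G) hl0
  -- If `N < w`, no state can lie on the boundary, so the flow out of `A` vanishes, which
  -- contradicts ergodicity.
  rcases Nat.lt_or_ge N w with hw | hw
  · have h0 : ∀ I ∈ A, ∀ J ∈ Aᶜ, glauber G lam I J = 0 := fun I hI J hJ => by
      by_contra h
      have := hb I hI J hJ h
      omega
    have := bottleneck_le (glauber_nonneg hl0) glauber_row_sum (hardCore_nonneg hl0)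
      (sum_hardCore hl0) (glauber_stationary hl0) A hA (mixingTime G lam)
      (tvDist_mixingTime_le hl0)
    rw [Finset.sum_eq_zero (s := A) (f := fun I => ∑ J ∈ Aᶜ, hardCore G lam I * glauber G lam I J)
      fun I hI => Finset.sum_eq_zero fun J hJ => by rw [h0 I hI J hJ, mul_zero]] at this
    have h1 : 0 < ∑ I ∈ A, hardCore G lam I :=
      Finset.sum_pos (fun I _ => div_pos (hardCoreWeight_pos hl0 I) hZ) ⟨I₀, hI₀⟩
    linarith
  have hflow : ∀ I ∈ A, ∑ J ∈ Aᶜ, hardCore G lam I * glauber G lam I J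
      ≤ lam ^ (N - w) / partitionFunction G lam := by
    intro I hI
    by_cases h : ∃ J ∈ Aᶜ, glauber G lam I J ≠ 0
    · obtain ⟨J, hJ, hIJ⟩ := h
      have h1 := hb I hI J hJ hIJ
      refine le_trans ?_ (hardCore_le hl (I := I) (M := N - w) (by omega))
      rw [← Finset.mul_sum]
      refine mul_le_of_le_one_right (hardCore_nonneg hl0 I) ?_
      rw [← glauber_row_sum (G := G) (lam := lam) I]
      exact Finset.sum_le_univ_sum_of_nonneg fun J => glauber_nonneg hl0 _ _
    · push Not at h
      rw [Finset.sum_eq_zero fun J hJ => by rw [h J hJ, mul_zero]]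
      positivity
  have hcard : (A.card : ℝ) ≤ 2 ^ Fintype.card V := by
    have h1 : A.card ≤ Fintype.card (Finset V) :=
      (Finset.card_le_univ A).trans (Fintype.card_le_of_injective _ Subtype.val_injective)
    rw [Fintype.card_finset] at h1
    exact_mod_cast h1
  have hQ : ∑ I ∈ A, ∑ J ∈ Aᶜ, hardCore G lam I * glauber G lam I J
      ≤ 2 ^ Fintype.card V * (lam ^ (N - w) / partitionFunction G lam) := by
    refine (Finset.sum_le_card_nsmul _ _ _ hflow).trans ?_
    rw [nsmul_eq_mul]
    exact mul_le_mul_of_nonneg_right hcard (by positivity)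
  have hmass : lam ^ N / partitionFunction G lam ≤ ∑ I ∈ A, hardCore G lam I := by
    rw [← hN]
    exact Finset.single_le_sum (f := hardCore G lam) (fun I _ => hardCore_nonneg hl0 I) hI₀
  have hbot := bottleneck_le (glauber_nonneg hl0) glauber_row_sum (hardCore_nonneg hl0)
    (sum_hardCore hl0) (glauber_stationary hl0) A hA (mixingTime G lam) (tvDist_mixingTime_le hl0)
  have h1 : lam ^ N / partitionFunction G lam ≤ 4 * (mixingTime G lam *
      (2 ^ Fintype.card V * (lam ^ (N - w) / partitionFunction G lam))) :=
    hmass.trans (hbot.trans (mul_le_mul_of_nonneg_left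
      (mul_le_mul_of_nonneg_left hQ (Nat.cast_nonneg _)) (by norm_num)))
  have h2 : lam ^ N = lam ^ w * lam ^ (N - w) := by rw [← pow_add, Nat.add_sub_cancel' hw]
  rw [h2] at h1
  have hc : 0 < lam ^ (N - w) / partitionFunction G lam := by positivity
  rw [mul_div_assoc] at h1
  refine le_of_mul_le_mul_right (h1.trans (le_of_eq ?_)) hc
  ring

/-- If the independent sets meeting `U` in `k` or `k + 1` vertices are all smaller by `w` than some
independent sets on either side, then Glauber dynamics mixes slowly. -/
theorem pow_le_mixingTime [Nonempty V] (hl : 1 ≤ lam) (U : Set V) {k N w : ℕ}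
    (hb : ∀ I : IndepSets G, occupancy U I = k ∨ occupancy U I = k + 1 → I.1.card + w ≤ N)
    (hlo : ∃ I : IndepSets G, occupancy U I ≤ k ∧ I.1.card = N)
    (hhi : ∃ I : IndepSets G, k < occupancy U I ∧ I.1.card = N) :
    lam ^ w ≤ 4 * (mixingTime G lam * 2 ^ Fintype.card V) := by
  classical
  set A : Finset (IndepSets G) := {I | k < occupancy U I} with hAdef
  have hA : ∀ I, I ∈ A ↔ k < occupancy U I := fun I => by simp [hAdef]
  have hsum := Finset.sum_add_sum_compl A (hardCore G lam)
  rw [sum_hardCore (zero_lt_one.trans_le hl)] at hsum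
  -- The lighter side serves as the set to escape from. One update changes the occupancy by at most
  -- one, so exits start at occupancy exactly `k + 1` from `A` and exactly `k` from `Aᶜ`.
  rcases le_total (∑ I ∈ A, hardCore G lam I) (1 / 2) with h | h
  · obtain ⟨I₀, h1, h2⟩ := hhi
    refine pow_le_mixingTime_of_cut hl A h ((hA I₀).2 h1) h2 fun I hI J hJ hIJ => hb I ?_
    have := occupancy_le_succ_of_glauber_ne_zero U hIJ
    rw [Finset.mem_compl] at hJ
    rw [hA] at hI hJ
    omega
  · obtain ⟨I₀, h1, h2⟩ := hlo
    refine pow_le_mixingTime_of_cut hl Aᶜ (by linarith)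
      (by rw [Finset.mem_compl, hA]; omega) h2 fun I hI J hJ hIJ => hb I ?_
    have := occupancy_le_succ_of_glauber_ne_zero U hIJ
    rw [compl_compl] at hJ
    rw [Finset.mem_compl] at hI
    rw [hA] at hI hJ
    omega

end Glauber

/-! ### Existence of two jointly expanding permutations. -/

section ExpandingPermutations

open Finset in
/-- The number of permutations mapping a given set of size `s` into `R`, by double counting. -/
theorem card_perm_map_subset_mul {α : Type*} [Fintype α] [DecidableEq α] (S R : Finset α) :
    #{π : Equiv.Perm α | S.map π.toEmbedding ⊆ R} * (Fintype.card α).choose #S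
      = (#R).choose #S * (Fintype.card α).factorial := by
  -- The count depends only on the size of the set, since permutations act transitively on sets of a
  -- given size.
  have hconst : ∀ S' ∈ powersetCard #S (univ : Finset α),
      #{π : Equiv.Perm α | S'.map π.toEmbedding ⊆ R}
        = #{π : Equiv.Perm α | S.map π.toEmbedding ⊆ R} := by
    intro S' hS'
    obtain ⟨g, rfl⟩ := Equiv.Perm.exists_map_finset_eq S S' (mem_powersetCard.1 hS').2.symm
    refine card_bij (fun π _ => g.trans π) (fun π hπ => ?_) (fun π _ π' _ h => ?_) fun π hπ => ?_
    · simp only [mem_filter, mem_univ, true_and] at hπ ⊢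
      rwa [map_map] at hπ
    · exact Equiv.ext fun x => by simpa using Equiv.congr_fun h (g.symm x)
    · refine ⟨g.symm.trans π, ?_, ?_⟩
      · simp only [mem_filter, mem_univ, true_and] at hπ ⊢
        rw [map_map]
        convert hπ using 2
        ext x; simp
      · ext x; simp
  have himg : ∀ π : Equiv.Perm α,
      #{S' ∈ powersetCard #S (univ : Finset α) | S'.map π.toEmbedding ⊆ R} = (#R).choose #S := by
    intro π
    rw [← card_powersetCard]
    refine card_bij (fun S' _ => S'.map π.toEmbedding) (fun S' h => ?_) (fun S' _ S'' _ h => ?_)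
      fun S' h => ?_
    · simp only [mem_filter, mem_powersetCard] at h ⊢
      exact ⟨h.2, by rw [card_map, h.1.2]⟩
    · exact map_injective _ h
    · rw [mem_powersetCard] at h
      have h1 : (S'.map π.symm.toEmbedding).map π.toEmbedding = S' := by
        rw [map_map]; ext x; simp
      refine ⟨S'.map π.symm.toEmbedding, ?_, h1⟩
      simp only [mem_filter, mem_powersetCard]
      exact ⟨⟨subset_univ _, by rw [card_map, h.2]⟩, by rw [h1]; exact h.1⟩
  have h1 : ∑ S' ∈ powersetCard #S (univ : Finset α),
        #{π : Equiv.Perm α | S'.map π.toEmbedding ⊆ R}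
      = ∑ π : Equiv.Perm α,
        #{S' ∈ powersetCard #S (univ : Finset α) | S'.map π.toEmbedding ⊆ R} :=
    sum_card_bipartiteAbove_eq_sum_card_bipartiteBelow _
  rw [sum_congr rfl hconst, sum_congr rfl fun π _ => himg π] at h1
  simp only [sum_const, smul_eq_mul, card_powersetCard, card_univ, Fintype.card_perm] at h1
  rw [mul_comm, h1, mul_comm]

-- A union bound: there are `m.choose s * (m - s).choose s` pairs `(S, T)`, and independent random
-- `ρ`, `σ` both avoid `T` on `S` with probability `((m - s).choose s / m.choose s) ^ 2`. The
-- product is less than `1` by `hC`.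
open Finset in
theorem exists_expanding_perms {α : Type*} [Fintype α] [DecidableEq α] {m s : ℕ}
    (hm : Fintype.card α = m) (hC : (m - s).choose s ^ 3 < m.choose s) :
    ∃ ρ σ : Equiv.Perm α, ∀ S T : Finset α, #S = s → #T = s → Disjoint S T →
      ∃ y ∈ S, ρ y ∈ T ∨ σ y ∈ T := by
  by_contra! hbad
  set F : Finset α → Finset α → Finset (Equiv.Perm α) :=
    fun S T => {π | S.map π.toEmbedding ⊆ Tᶜ} with hF
  have hcover : (univ : Finset (Equiv.Perm α × Equiv.Perm α)) ⊆
      ((powersetCard s (univ : Finset α)).sigma fun S => powersetCard s Sᶜ).biUnion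
        fun p => F p.1 p.2 ×ˢ F p.1 p.2 := by
    rintro ⟨ρ, σ⟩ -
    obtain ⟨S, T, hS, hT, hST, h⟩ := hbad ρ σ
    simp only [mem_biUnion, mem_sigma, mem_powersetCard, subset_univ, true_and, mem_product, hF,
      mem_filter, mem_univ]
    refine ⟨⟨S, T⟩, ⟨hS, ?_, hT⟩, ?_, ?_⟩
    · exact fun x hx => mem_compl.2 fun hxS => disjoint_left.1 hST hxS hx
    · intro x hx
      obtain ⟨y, hy, rfl⟩ := mem_map.1 hx
      exact mem_compl.2 (h y hy).1
    · intro x hx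
      obtain ⟨y, hy, rfl⟩ := mem_map.1 hx
      exact mem_compl.2 (h y hy).2
  have hcount : m.factorial ^ 2 * m.choose s ^ 2
      ≤ m.choose s * (m - s).choose s * ((m - s).choose s * m.factorial) ^ 2 := by
    have h1 := (card_le_card hcover).trans card_biUnion_le
    rw [card_univ, Fintype.card_prod, Fintype.card_perm, hm, sum_sigma] at h1
    rw [← pow_two] at h1
    refine (Nat.mul_le_mul_right _ h1).trans (le_of_eq ?_)
    rw [sum_mul]
    simp_rw [sum_mul]
    have h2 : ∀ S ∈ powersetCard s (univ : Finset α), ∀ T ∈ powersetCard s Sᶜ,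
        #(F S T ×ˢ F S T) * m.choose s ^ 2 = ((m - s).choose s * m.factorial) ^ 2 := by
      intro S hS T hT
      rw [mem_powersetCard] at hS hT
      have := card_perm_map_subset_mul S Tᶜ
      rw [card_compl, hm, hS.2, hT.2] at this
      rw [card_product, ← this]
      ring
    rw [sum_congr rfl fun S hS => sum_congr rfl (h2 S hS)]
    have h3 : ∀ S ∈ powersetCard s (univ : Finset α), #(powersetCard s Sᶜ) = (m - s).choose s :=
      fun S hS => by rw [card_powersetCard, card_compl, hm, (mem_powersetCard.1 hS).2]
    simp_rw [sum_const, smul_eq_mul]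
    rw [sum_congr rfl fun S hS => by rw [h3 S hS]]
    rw [sum_const, card_powersetCard, card_univ, hm, smul_eq_mul, mul_assoc]
  have hpos : 0 < m.choose s := lt_of_le_of_lt (Nat.zero_le _) hC
  have h4 : m.choose s * (m.factorial ^ 2 * m.choose s)
      ≤ m.choose s * (m.factorial ^ 2 * (m - s).choose s ^ 3) := by
    calc _ = m.factorial ^ 2 * m.choose s ^ 2 := by ring
      _ ≤ _ := hcount
      _ = _ := by ring
  exact absurd (Nat.le_of_mul_le_mul_left (Nat.le_of_mul_le_mul_left h4 hpos)
    (pow_pos m.factorial_pos 2)) (not_le.2 hC)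

theorem two_pow_le_centralBinom (s : ℕ) : 2 ^ s ≤ s.centralBinom := by
  induction s with
  | zero => simp
  | succ s ih =>
    refine Nat.le_of_mul_le_mul_left ?_ s.succ_pos
    rw [Nat.succ_eq_add_one, Nat.succ_mul_centralBinom_succ, pow_succ]
    nlinarith

/-- One binomial term of `(20 + 1) ^ (21 * u)` gives the bound `(21 ^ 21 / 20 ^ 20) ^ u ≤ 56 ^ u`,
and `56 ^ 3 < 2 ^ 20`, while the right side is at least the central coefficient, hence at least `2 ^
(20 * u)`. -/
theorem choose_pow_three_lt {u : ℕ} (hu : 0 < u) :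
    (41 * u - 20 * u).choose (20 * u) ^ 3 < (41 * u).choose (20 * u) := by
  have e : 41 * u - 20 * u = 21 * u := by omega
  rw [e]
  have h1 : (21 * u).choose (20 * u) ≤ 56 ^ u := by
    have h2 : 20 ^ (20 * u) * (21 * u).choose (20 * u) ≤ 21 ^ (21 * u) := by
      have := add_pow 20 1 (21 * u)
      rw [show 20 + 1 = 21 from rfl] at this
      rw [this]
      refine le_trans (le_of_eq ?_) (Finset.single_le_sum (fun i _ => Nat.zero_le _)
        (Finset.mem_range.2 (show 20 * u < 21 * u + 1 by omega)))
      simp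
    have h3 : 21 ^ (21 * u) ≤ 20 ^ (20 * u) * 56 ^ u := by
      rw [pow_mul, pow_mul, ← mul_pow]
      exact Nat.pow_le_pow_left (by norm_num) u
    exact Nat.le_of_mul_le_mul_left (h2.trans h3) (by positivity)
  calc (21 * u).choose (20 * u) ^ 3 ≤ (56 ^ u) ^ 3 := Nat.pow_le_pow_left h1 3
    _ = (56 ^ 3) ^ u := by rw [← pow_mul, ← pow_mul, mul_comm]
    _ < (2 ^ 20) ^ u := Nat.pow_lt_pow_left (by norm_num) hu.ne'
    _ = 2 ^ (20 * u) := by rw [pow_mul]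
    _ ≤ (20 * u).centralBinom := two_pow_le_centralBinom _
    _ = (2 * (20 * u)).choose (20 * u) := Nat.centralBinom_eq_two_mul_choose _
    _ ≤ (41 * u).choose (20 * u) := Nat.choose_le_choose _ (by omega)

end ExpandingPermutations

/-! ### Recognising paths by degrees. -/

section PathsAndClaws

theorem exists_adj_dist_eq {W : Type*} {H : SimpleGraph W} (hc : H.Connected) {r u : W} {k : ℕ}
    (h : H.dist r u = k + 1) : ∃ x, H.Adj u x ∧ H.dist r x = k := by
  obtain ⟨p, hp⟩ := hc.exists_walk_length_eq_dist u r
  rw [SimpleGraph.dist_comm, h] at hp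
  cases p with
  | nil => simp at hp
  | @cons _ x _ hadj q =>
    refine ⟨x, hadj, le_antisymm ?_ ?_⟩
    · rw [SimpleGraph.dist_comm]
      refine (SimpleGraph.dist_le q).trans ?_
      simpa using hp.le
    · have h1 := hc.dist_triangle (u := r) (v := x) (w := u)
      rw [SimpleGraph.dist_eq_one_iff_adj.2 hadj.symm, h] at h1
      omega

-- Distance from the end `r` is injective: two vertices at equal positive distance share their
-- predecessor by induction, which would then have degree at least `3`, or `2` if it is `r`.
open Classical in
theorem isPathGraph_of_degree_le_two {W : Type*} [Fintype W] {H : SimpleGraph W}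
    (hc : H.Connected) (h2 : ∀ v, H.degree v ≤ 2) {r : W} (hr : H.degree r ≤ 1) :
    IsPathGraph H := by
  have hinj : ∀ k, ∀ u v, H.dist r u = k → H.dist r v = k → u = v := by
    intro k
    induction k with
    | zero =>
      intro u v hu hv
      rw [hc.dist_eq_zero_iff] at hu hv
      exact hu.symm.trans hv
    | succ k ih =>
      intro u v hu hv
      obtain ⟨x, hux, hx⟩ := exists_adj_dist_eq hc hu
      obtain ⟨x', hvx, hx'⟩ := exists_adj_dist_eq hc hv
      obtain rfl := ih x x' hx hx'
      by_contra huv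
      cases k with
      | zero =>
        rw [hc.dist_eq_zero_iff] at hx
        subst hx
        have : 1 < (H.neighborFinset r).card := Finset.one_lt_card.2
          ⟨u, by simpa using hux.symm, v, by simpa using hvx.symm, huv⟩
        rw [SimpleGraph.card_neighborFinset_eq_degree] at this
        omega
      | succ j =>
        obtain ⟨y, hxy, hy⟩ := exists_adj_dist_eq hc hx
        have : 2 < (H.neighborFinset x).card := Finset.two_lt_card.2
          ⟨u, by simpa using hux.symm, v, by simpa using hvx.symm, y, by simpa using hxy, huv,
            by rintro rfl; omega, by rintro rfl; omega⟩
        rw [SimpleGraph.card_neighborFinset_eq_degree] at this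
        have := h2 x
        omega
  have hlt : ∀ v, H.dist r v < Fintype.card W := fun v => by
    obtain ⟨p, hp, hl⟩ := hc.exists_path_of_dist r v
    rw [← hl]
    exact hp.length_lt
  have hbij : Function.Bijective fun v => (⟨H.dist r v, hlt v⟩ : Fin (Fintype.card W)) := by
    rw [Fintype.bijective_iff_injective_and_card]
    exact ⟨fun u v h => hinj _ u v rfl (Fin.mk.inj h).symm, by simp⟩
  refine ⟨Fintype.card W, ⟨⟨Equiv.ofBijective _ hbij, ?_⟩⟩⟩
  intro u v
  have hup : ∀ u v, H.dist r u + 1 = H.dist r v → H.Adj v u := fun u v h => by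
    obtain ⟨x, hx, hd⟩ := exists_adj_dist_eq hc h.symm
    rwa [hinj _ u x rfl hd]
  simp only [Equiv.ofBijective_apply, SimpleGraph.pathGraph_adj]
  constructor
  · rintro (h | h)
    · exact (hup _ _ h).symm
    · exact hup _ _ h
  · intro h
    have hne : H.dist r u ≠ H.dist r v := fun h' => h.ne (hinj _ u v h' rfl)
    rcases h.diff_dist_adj (u := r) with h' | h' | h' <;> omega

end PathsAndClaws

/-! ### Level maps to a cycle, and small connected graphs carrying them. -/

section Levellings

/-- A map of the vertices to a cycle of length `4 * l` in which neighbours go to neighbours, and in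
which all vertices outside the two levels `0` and `2 * l - 1` have at most one neighbour above and
at most one below. -/
structure IsLevelling {V : Type*} (G : SimpleGraph V) (l : ℕ) (h : V → ZMod (4 * l)) : Prop where
  adj : ∀ {u v}, G.Adj u v → h v - h u = 1 ∨ h v - h u = -1
  straight : ∀ {x u v}, h x ≠ 0 → h x ≠ 2 * l - 1 → G.Adj x u → G.Adj x v → u ≠ v →
    h v - h x = h x - h u

theorem IsLevelling.comap {V W : Type*} {G : SimpleGraph V} {H : SimpleGraph W} {l : ℕ}
    {h : V → ZMod (4 * l)} (hh : IsLevelling G l h) (f : H ↪g G) : IsLevelling H l (h ∘ f) where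
  adj huv := hh.adj (f.map_adj_iff.2 huv)
  straight h0 h1 hu hv huv := hh.straight h0 h1 (f.map_adj_iff.2 hu) (f.map_adj_iff.2 hv)
    (f.injective.ne huv)

theorem intCast_zmod_ne_zero {n : ℕ} {z : ℤ} (h0 : z ≠ 0) (h1 : |z| < n) : (z : ZMod n) ≠ 0 := by
  rw [Ne, ZMod.intCast_zmod_eq_zero_iff_dvd]
  exact fun hd => h0 (Int.eq_zero_of_abs_lt_dvd hd h1)

variable {W : Type*} {H : SimpleGraph W} {l : ℕ} {h : W → ZMod (4 * l)}

/-- The levels of the two kinds of branching vertices are far from each other. -/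
theorem not_branch_level {b s : ZMod (4 * l)} (hb : b = 0 ∨ b = 2 * l - 1) (hs : s = 1 ∨ s = -1)
    {i : ℕ} (h0 : 0 < i) (hi : i < l) : b + i * s ≠ 0 ∧ b + i * s ≠ 2 * l - 1 := by
  have key : ∀ z : ℤ, z ≠ 0 → |z| < ((4 * l : ℕ) : ℤ) → (z : ZMod (4 * l)) ≠ 0 :=
    fun z => intCast_zmod_ne_zero
  rw [← sub_ne_zero (b := (2 * l - 1 : ZMod (4 * l)))]
  rcases hb with rfl | rfl <;> rcases hs with rfl | rfl
  · exact ⟨by have := key i (by omega) (by rw [abs_lt]; push_cast; omega); push_cast at this; simpa,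
      by
        have := key (i - (2 * l - 1)) (by omega) (by rw [abs_lt]; push_cast; omega)
        push_cast at this; simpa⟩
  · exact ⟨by have := key (-i) (by omega) (by rw [abs_lt]; push_cast; omega); push_cast at this; simpa,
      by
        have := key (-i - (2 * l - 1)) (by omega) (by rw [abs_lt]; push_cast; omega)
        push_cast at this; simpa⟩
  · exact ⟨by
        have := key (2 * l - 1 + i) (by omega) (by rw [abs_lt]; push_cast; omega)
        push_cast at this; simpa,
      by have := key i (by omega) (by rw [abs_lt]; push_cast; omega); push_cast at this; simpa⟩
  · exact ⟨by
        have := key (2 * l - 1 - i) (by omega) (by rw [abs_lt]; push_cast; omega)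
        push_cast at this; simpa [sub_eq_add_neg] using this,
      by have := key (-i) (by omega) (by rw [abs_lt]; push_cast; omega); push_cast at this; simpa⟩

/-- Along a non-backtracking sequence of vertices the level changes at constant speed until a
branching vertex is reached. -/
theorem IsLevelling.linear (hh : IsLevelling H l h) {f : ℕ → W} {k : ℕ}
    (hadj : ∀ i < k, H.Adj (f i) (f (i + 1))) (hne : ∀ i, i + 2 ≤ k → f i ≠ f (i + 2))
    (hnb : ∀ i, 0 < i → i < k → h (f i) = h (f 0) + i * (h (f 1) - h (f 0)) →
      h (f i) ≠ 0 ∧ h (f i) ≠ 2 * l - 1) :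
    ∀ i ≤ k, h (f i) = h (f 0) + i * (h (f 1) - h (f 0)) := by
  intro i
  induction i using Nat.strong_induction_on with
  | _ i ih =>
    intro hi
    match i with
    | 0 => simp
    | 1 => simp
    | j + 2 =>
      have h1 := ih j (by omega) (by omega)
      have h2 := ih (j + 1) (by omega) (by omega)
      obtain ⟨h3, h4⟩ := hnb (j + 1) (by omega) (by omega) h2
      have h5 := hh.straight h3 h4 (hadj j (by omega)).symm (hadj (j + 1) (by omega))
        (hne j hi)
      rw [sub_eq_iff_eq_add] at h5
      rw [h5, h2, h1]
      push_cast
      ring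

theorem IsLevelling.linear_of_branch (hh : IsLevelling H l h) {f : ℕ → W} {k : ℕ} (hk : k ≤ l)
    (hadj : ∀ i < k, H.Adj (f i) (f (i + 1))) (hne : ∀ i, i + 2 ≤ k → f i ≠ f (i + 2))
    (h0 : h (f 0) = 0 ∨ h (f 0) = 2 * l - 1) :
    ∀ i ≤ k, h (f i) = h (f 0) + i * (h (f 1) - h (f 0)) := by
  refine hh.linear hadj hne fun i hi hik hl => ?_
  rw [hl]
  exact not_branch_level h0 (hh.adj (hadj 0 (by omega))) hi (by omega)

/-- Rotate a cycle to start at a branching level if it meets one. The level then changes at constant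
speed `±1` all the way round, so the length of the cycle would vanish modulo `4 * l`, although it is
positive and less than `l`. -/
theorem IsLevelling.isAcyclic [Fintype W] (hh : IsLevelling H l h) (hl : Fintype.card W < l) :
    H.IsAcyclic := by
  classical
  have main : ∀ (v : W) (c : H.Walk v v), c.IsCycle → (h v = 0 ∨ h v = 2 * l - 1) ∨
      (∀ x ∈ c.support, h x ≠ 0 ∧ h x ≠ 2 * l - 1) → False := by
    intro v c hc hb
    have h3 := hc.three_le_length
    have hlen : c.length ≤ Fintype.card W := by
      have := hc.support_nodup.length_le_card
      simpa using this
    have hadj : ∀ i < c.length, H.Adj (c.getVert i) (c.getVert (i + 1)) :=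
      fun i hi => c.adj_getVert_succ hi
    have hne : ∀ i, i + 2 ≤ c.length → c.getVert i ≠ c.getVert (i + 2) := fun i hi =>
      hc.getVert_sub_one_ne_getVert_add_one (i := i + 1) (by omega)
    have hlin : h (c.getVert c.length)
        = h (c.getVert 0) + c.length * (h (c.getVert 1) - h (c.getVert 0)) := by
      rcases hb with hb | hb
      · exact hh.linear_of_branch (by omega) hadj hne (by simpa using hb) _ le_rfl
      · exact hh.linear hadj hne (fun i _ _ _ => hb _ (c.getVert_mem_support i)) _ le_rfl
    have hs := hh.adj (hadj 0 (by omega))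
    rw [c.getVert_length, c.getVert_zero, left_eq_add] at hlin
    have hz : ((c.length : ℤ) : ZMod (4 * l)) ≠ 0 :=
      intCast_zmod_ne_zero (by omega) (by rw [abs_lt]; push_cast; omega)
    push_cast at hz
    rw [c.getVert_zero] at hs
    rcases hs with hs | hs <;> rw [zero_add] at hs <;> rw [hs] at hlin <;> simp [hz] at hlin
  intro v c hc
  by_cases hb : ∃ x ∈ c.support, h x = 0 ∨ h x = 2 * l - 1
  · obtain ⟨x, hx, hbx⟩ := hb
    exact main x _ (hc.rotate hx) (Or.inl hbx)
  · push Not at hb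
    exact main v c hc (Or.inr hb)

/-- A path leaving `u` moves linearly in level for fewer than `l` steps, too few to reach a
branching level again. -/
theorem IsLevelling.eq_of_branch [Fintype W] (hh : IsLevelling H l h) (hl : Fintype.card W < l)
    (hc : H.Connected) {u v : W} (hu : h u = 0 ∨ h u = 2 * l - 1)
    (hv : h v = 0 ∨ h v = 2 * l - 1) : u = v := by
  obtain ⟨p, hp⟩ := hc.exists_isPath u v
  by_contra huv
  have hpos : 0 < p.length := by
    rw [Nat.pos_iff_ne_zero]
    exact fun h0 => huv (SimpleGraph.Walk.eq_of_length_eq_zero h0)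
  have hlen := hp.length_lt
  have hadj : ∀ i < p.length, H.Adj (p.getVert i) (p.getVert (i + 1)) :=
    fun i hi => p.adj_getVert_succ hi
  have hne : ∀ i, i + 2 ≤ p.length → p.getVert i ≠ p.getVert (i + 2) := fun i hi heq => by
    have := hp.getVert_injOn (show i ≤ p.length by omega) (show i + 2 ≤ p.length from hi) heq
    omega
  have hlin := hh.linear_of_branch (by omega) hadj hne (by simpa using hu) _ le_rfl
  have hs := hh.adj (hadj 0 hpos)
  rw [zero_add] at hs
  rw [p.getVert_length, p.getVert_zero] at hlin
  rw [p.getVert_zero] at hs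
  have := not_branch_level hu hs hpos (by omega)
  rw [← hlin] at this
  rcases hv with hv | hv
  · exact this.1 hv
  · exact this.2 hv

-- Three neighbours at a straight vertex would have pairwise opposite level differences, forcing `2
-- * (±1) = 0` modulo `4 * l`.
open Classical in
theorem IsLevelling.branch_of_degree [Fintype W] (hh : IsLevelling H l h) (hl : 0 < l) {x : W}
    (hx : 2 < H.degree x) : h x = 0 ∨ h x = 2 * l - 1 := by
  by_contra! hb
  rw [← SimpleGraph.card_neighborFinset_eq_degree, Finset.two_lt_card] at hx
  obtain ⟨a, ha, b, hb', c, hc, hab, hac, hbc⟩ := hx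
  rw [SimpleGraph.mem_neighborFinset] at ha hb' hc
  have h1 := hh.straight hb.1 hb.2 ha hb' hab
  have h2 := hh.straight hb.1 hb.2 ha hc hac
  have h3 := hh.straight hb.1 hb.2 hb' hc hbc
  have h4 := hh.adj ha
  have hz : ((2 : ℤ) : ZMod (4 * l)) ≠ 0 :=
    intCast_zmod_ne_zero (by omega) (by rw [abs_lt]; push_cast; omega)
  push_cast at hz
  have h5 : 2 * (h a - h x) = 0 := by
    linear_combination h1 + h2 - h3
  rcases h4 with h4 | h4 <;> rw [h4] at h5 <;> simp [hz] at h5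

open Classical in
/-- A connected graph of maximum degree at most `3` which is small relative to a levelling is a
subdivided claw or a path. -/
theorem IsLevelling.isSubdividedClaw_or_isPathGraph [Fintype W] (hh : IsLevelling H l h)
    (hl : Fintype.card W < l) (hc : H.Connected) (h3 : ∀ v, H.degree v ≤ 3) :
    IsSubdividedClaw H ∨ IsPathGraph H := by
  have htree : H.IsTree := ⟨hc, hh.isAcyclic hl⟩
  by_cases hv : ∃ v, H.degree v = 3
  · obtain ⟨v, hv⟩ := hv
    refine Or.inl ⟨htree, v, by convert hv, fun u huv => ?_⟩
    have hu : H.degree u ≤ 2 := by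
      by_contra! hu
      exact huv (hh.eq_of_branch hl hc (hh.branch_of_degree (by omega) hu)
        (hh.branch_of_degree (by omega) (by omega)))
    have : Nontrivial W := ⟨u, v, huv⟩
    have hpos := hc.preconnected.degree_pos_of_nontrivial u
    have : H.degree u = 1 ∨ H.degree u = 2 := by omega
    convert this
  · push Not at hv
    have h2 : ∀ v, H.degree v ≤ 2 := fun v => by
      have := h3 v
      have := hv v
      omega
    right
    rcases subsingleton_or_nontrivial W with hW | hW
    · obtain ⟨r⟩ := hc.nonempty
      refine isPathGraph_of_degree_le_two hc h2 (r := r) ?_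
      have := H.degree_lt_card_verts r
      have := Fintype.card_le_one_iff_subsingleton.2 hW
      omega
    · obtain ⟨r, hr⟩ := htree.exists_vert_degree_one_of_nontrivial
      exact isPathGraph_of_degree_le_two hc h2 hr.le

end Levellings

/-! ### Independent sets in bipartite double covers. -/

section DoubleCover

variable {D : Type*}

/-- The bipartite double cover of the reflexive closure of a digraph: every node `e` becomes an edge
between `(e, true)` and `(e, false)`, and every arrow from `e` to `e'` an edge between `(e, true)`
and `(e', false)`. -/
def doubleCover (R : D → D → Prop) : SimpleGraph (D × Bool) where
  Adj a b := (a.2 = true ∧ b.2 = false ∧ (a.1 = b.1 ∨ R a.1 b.1)) ∨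
    (b.2 = true ∧ a.2 = false ∧ (b.1 = a.1 ∨ R b.1 a.1))
  symm := ⟨fun _ _ h => h.symm⟩
  loopless := ⟨fun a h => by rcases h with h | h <;> simp_all⟩

variable {R : D → D → Prop}

theorem doubleCover_adj_true {e : D} {x : D × Bool} :
    (doubleCover R).Adj (e, true) x ↔ x.2 = false ∧ (e = x.1 ∨ R e x.1) := by
  simp [doubleCover]

theorem doubleCover_adj_false {e : D} {x : D × Bool} :
    (doubleCover R).Adj (e, false) x ↔ x.2 = true ∧ (x.1 = e ∨ R x.1 e) := by
  simp [doubleCover]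

variable [Fintype D]

open Classical in
/-- The nodes of which neither copy is occupied. -/
noncomputable def vacantNodes (I : IndepSets (doubleCover R)) : Finset D :=
  {e | (e, true) ∉ I.1 ∧ (e, false) ∉ I.1}

/-- The two copies of a node are adjacent, so each node contributes at most one vertex. -/
theorem card_add_card_vacantNodes (I : IndepSets (doubleCover R)) :
    I.1.card + (vacantNodes I).card = Fintype.card D := by
  classical
  have h1 : vacantNodes I = (I.1.image Prod.fst)ᶜ := by
    ext e
    simp [vacantNodes, and_comm]
  have h2 : (I.1.image Prod.fst).card = I.1.card := by
    refine Finset.card_image_of_injOn ?_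
    rintro ⟨e, b⟩ hb ⟨e', b'⟩ hb' h
    obtain rfl : e = e' := h
    by_contra hne
    refine I.2 hb hb' hne ?_
    cases b <;> cases b' <;> simp_all [doubleCover]
  rw [h1, ← h2]
  exact Finset.card_add_card_compl _

/-- The vertex `(e, true)` blocks `(e', false)`, so a nonvacant `e'` must be occupied on the `true`
side. -/
theorem occupied_of_arrow (I : IndepSets (doubleCover R)) {e e' : D} (hR : R e e')
    (he : (e, true) ∈ I.1) (he' : e' ∉ vacantNodes I) : (e', true) ∈ I.1 := by
  by_contra h
  refine he' ?_
  simp only [vacantNodes, Finset.mem_filter, Finset.mem_univ, true_and]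
  refine ⟨h, fun hf => I.2 he hf (by simp) ?_⟩
  simp [doubleCover, hR]

/-- The independent set of all vertices on one side. -/
theorem exists_indepSet_side (R : D → D → Prop) (b : Bool) :
    ∃ I : IndepSets (doubleCover R), (∀ x, x ∈ I.1 ↔ x.2 = b) ∧ I.1.card = Fintype.card D := by
  classical
  have hmem : ∀ x : D × Bool, x ∈ Finset.univ.image (fun e : D => (e, b)) ↔ x.2 = b := by
    rintro ⟨e, c⟩
    simp [eq_comm]
  refine ⟨⟨Finset.univ.image fun e : D => (e, b), ?_⟩, hmem, ?_⟩
  · intro x hx y hy _ hadj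
    rw [Finset.mem_coe, hmem] at hx hy
    rcases hadj with ⟨h1, h2, _⟩ | ⟨h1, h2, _⟩ <;> simp_all
  · exact Finset.card_image_of_injective _ fun _ _ h => (Prod.mk.inj h).1

end DoubleCover

/-! ### The stretched expander: its levelling and its degrees. -/

section Network

variable {Y : Type*} {l : ℕ}

/-- A digraph made of three directed paths with `l` nodes for every `y`: the end of the path
`(y, 0)` is joined to the starts of `(y, 1)` and `(y, 2)`, and the ends of these to the starts of
`(ρ y, 0)` and `(σ y, 0)`, respectively. -/
def NetworkArrow (ρ σ : Equiv.Perm Y) (e e' : Y × Fin 3 × Fin l) : Prop :=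
  (e'.1 = e.1 ∧ e'.2.1 = e.2.1 ∧ (e'.2.2 : ℕ) = e.2.2 + 1) ∨
    ((e.2.2 : ℕ) + 1 = l ∧ (e'.2.2 : ℕ) = 0 ∧
      ((e.2.1 = 0 ∧ e'.2.1 ≠ 0 ∧ e'.1 = e.1) ∨ (e.2.1 = 1 ∧ e'.2.1 = 0 ∧ e'.1 = ρ e.1) ∨
        (e.2.1 = 2 ∧ e'.2.1 = 0 ∧ e'.1 = σ e.1)))

/-- The graph used for slow mixing. -/
abbrev network (ρ σ : Equiv.Perm Y) (l : ℕ) : SimpleGraph ((Y × Fin 3 × Fin l) × Bool) :=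
  doubleCover (NetworkArrow ρ σ)

variable {ρ σ : Equiv.Perm Y}

theorem NetworkArrow.out_eq {e a b : Y × Fin 3 × Fin l} (ha : NetworkArrow ρ σ e a)
    (hb : NetworkArrow ρ σ e b) (h : ¬ (e.2.1 = 0 ∧ (e.2.2 : ℕ) + 1 = l)) : a = b := by
  obtain ⟨y, s, j⟩ := e
  obtain ⟨y₁, s₁, j₁⟩ := a
  obtain ⟨y₂, s₂, j₂⟩ := b
  simp only [NetworkArrow, Prod.mk.injEq, Fin.ext_iff] at *
  have := j₁.2
  have := j₂.2
  grind

theorem NetworkArrow.in_eq {e a b : Y × Fin 3 × Fin l} (ha : NetworkArrow ρ σ a e)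
    (hb : NetworkArrow ρ σ b e) (h : ¬ (e.2.1 = 0 ∧ (e.2.2 : ℕ) = 0)) : a = b := by
  obtain ⟨y, s, j⟩ := e
  obtain ⟨y₁, s₁, j₁⟩ := a
  obtain ⟨y₂, s₂, j₂⟩ := b
  simp only [NetworkArrow, Prod.mk.injEq, Fin.ext_iff] at *
  have := j₁.2
  have := j₂.2
  grind

theorem NetworkArrow.exists_out [NeZero l] (ρ σ : Equiv.Perm Y) (e : Y × Fin 3 × Fin l) :
    ∃ a b, ∀ e', NetworkArrow ρ σ e e' → e' = a ∨ e' = b := by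
  by_cases h : e.2.1 = 0 ∧ (e.2.2 : ℕ) + 1 = l
  · refine ⟨(e.1, 1, 0), (e.1, 2, 0), ?_⟩
    rintro ⟨y, s, j⟩ he'
    obtain ⟨y₁, s₁, j₁⟩ := e
    simp only [NetworkArrow, Prod.mk.injEq, Fin.ext_iff] at *
    have := j.2
    have := s.2
    simp only [Fin.val_zero, Fin.val_one, Fin.val_two] at *
    grind
  · by_cases h' : ∃ a, NetworkArrow ρ σ e a
    · obtain ⟨a, ha⟩ := h'
      exact ⟨a, a, fun e' he' => Or.inl (he'.out_eq ha h)⟩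
    · exact ⟨e, e, fun e' he' => absurd ⟨e', he'⟩ h'⟩

theorem NetworkArrow.exists_in [NeZero l] (ρ σ : Equiv.Perm Y) (e : Y × Fin 3 × Fin l) :
    ∃ a b, ∀ e', NetworkArrow ρ σ e' e → e' = a ∨ e' = b := by
  by_cases h : e.2.1 = 0 ∧ (e.2.2 : ℕ) = 0
  · have hl := NeZero.pos l
    refine ⟨(ρ.symm e.1, 1, ⟨l - 1, by omega⟩), (σ.symm e.1, 2, ⟨l - 1, by omega⟩), ?_⟩
    rintro ⟨y, s, j⟩ he'
    obtain ⟨y₁, s₁, j₁⟩ := e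
    simp only [NetworkArrow, Prod.mk.injEq, Fin.ext_iff, Equiv.eq_symm_apply] at *
    have := j.2
    have := s.2
    simp only [Fin.val_zero, Fin.val_one, Fin.val_two] at *
    grind
  · by_cases h' : ∃ a, NetworkArrow ρ σ a e
    · obtain ⟨a, ha⟩ := h'
      exact ⟨a, a, fun e' he' => Or.inl (he'.in_eq ha h)⟩
    · exact ⟨e, e, fun e' he' => absurd ⟨e', he'⟩ h'⟩

/-- The position of a node along the network. -/
def networkPosition (e : Y × Fin 3 × Fin l) : ℕ := if e.2.1 = 0 then e.2.2 else l + e.2.2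

/-- The level of a vertex of the network. -/
def networkLevel (x : (Y × Fin 3 × Fin l) × Bool) : ZMod (4 * l) :=
  2 * networkPosition x.1 + if x.2 then 1 else 0

theorem NetworkArrow.position {e e' : Y × Fin 3 × Fin l} (h : NetworkArrow ρ σ e e') :
    networkPosition e' = networkPosition e + 1 ∨
      networkPosition e' = 0 ∧ networkPosition e + 1 = 2 * l := by
  obtain ⟨y, s, j⟩ := e
  obtain ⟨y₁, s₁, j₁⟩ := e'
  simp only [NetworkArrow, networkPosition, Fin.ext_iff] at *
  have := j.2
  have := j₁.2
  grind

/-- At position `p` the copies have levels `2 * p` and `2 * p + 1`. The arrows closing the cycle go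
from `4 * l - 1` to `0`. -/
theorem NetworkArrow.level {e e' : Y × Fin 3 × Fin l} (h : NetworkArrow ρ σ e e') :
    networkLevel (e', false) - networkLevel (e, true) = 1 := by
  simp only [networkLevel]
  rcases h.position with h | ⟨h, h'⟩
  · rw [h]; push_cast; simp; ring
  · have h2 : ((4 * l : ℕ) : ZMod (4 * l)) = 0 := ZMod.natCast_self _
    have h3 : (networkPosition e : ZMod (4 * l)) = 2 * l - 1 := by
      rw [eq_sub_iff_add_eq]; exact_mod_cast congrArg (Nat.cast : ℕ → ZMod (4 * l)) h'
    push_cast at h2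
    rw [h, h3]
    simp
    linear_combination -h2

theorem networkLevel_true_sub_false (e : Y × Fin 3 × Fin l) :
    networkLevel (e, true) - networkLevel (e, false) = 1 := by
  simp [networkLevel]

/-- A `true` vertex has its twin below and its out-neighbours above; a `false` vertex has its twin
above and its in-neighbours below. Two arrows leave only the ends of paths `(y, 0)`, at level `2 * l
- 1`, and two enter only their starts, at level `0`. -/
theorem network_isLevelling (ρ σ : Equiv.Perm Y) (l : ℕ) :
    IsLevelling (network ρ σ l) l networkLevel where
  adj := by
    have key : ∀ e : Y × Fin 3 × Fin l, ∀ v, (network ρ σ l).Adj (e, true) v →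
        networkLevel v - networkLevel (e, true) = 1 ∨
        networkLevel v - networkLevel (e, true) = -1 := by
      rintro e ⟨e', b⟩ h
      obtain ⟨rfl, h⟩ := doubleCover_adj_true.1 h
      simp only at h
      rcases h with rfl | h
      · right; rw [← networkLevel_true_sub_false e]; ring
      · left; exact h.level
    rintro ⟨e, b⟩ ⟨e', b'⟩ h
    cases b
    · obtain rfl : b' = true := (doubleCover_adj_false.1 h).1
      rcases key e' _ h.symm with h | h
      · right; rw [← h]; ring
      · left; rw [← neg_sub, h, neg_neg]
    · exact key e _ h
  straight := by
    rintro ⟨e, b⟩ ⟨e₁, b₁⟩ ⟨e₂, b₂⟩ h0 h1 hu hv huv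
    cases b
    · obtain ⟨rfl, hu⟩ := doubleCover_adj_false.1 hu
      obtain ⟨rfl, hv⟩ := doubleCover_adj_false.1 hv
      have hb : ¬ (e.2.1 = 0 ∧ (e.2.2 : ℕ) = 0) := fun hb => h0 (by
        simp [networkLevel, networkPosition, hb.1, hb.2])
      simp only at hu hv
      have h2 := networkLevel_true_sub_false e
      rcases hu with rfl | hu <;> rcases hv with rfl | hv
      · exact absurd rfl huv
      · have h3 := hv.level
        linear_combination h2 - h3
      · have h3 := hu.level
        linear_combination h2 - h3
      · exact absurd (by rw [hu.in_eq hv hb]) huv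
    · obtain ⟨rfl, hu⟩ := doubleCover_adj_true.1 hu
      obtain ⟨rfl, hv⟩ := doubleCover_adj_true.1 hv
      have hb : ¬ (e.2.1 = 0 ∧ (e.2.2 : ℕ) + 1 = l) := fun hb => h1 (by
        have : ((e.2.2 : ℕ) : ZMod (4 * l)) = l - 1 := by
          rw [eq_sub_iff_add_eq]; exact_mod_cast congrArg (Nat.cast : ℕ → ZMod (4 * l)) hb.2
        simp only [networkLevel, networkPosition, hb.1, if_true, this]
        ring)
      simp only at hu hv
      have h2 := networkLevel_true_sub_false e
      rcases hu with rfl | hu <;> rcases hv with rfl | hv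
      · exact absurd rfl huv
      · have h3 := hv.level
        linear_combination h3 - h2
      · have h3 := hu.level
        linear_combination h3 - h2
      · exact absurd (by rw [hu.out_eq hv hb]) huv

theorem network_hasMaxDegree [Fintype Y] [Nonempty Y] [NeZero l] (hl : 2 ≤ l)
    (ρ σ : Equiv.Perm Y) : HasMaxDegree (network ρ σ l) 3 := by
  classical
  unfold HasMaxDegree
  have hle : ∀ x, (network ρ σ l).degree x ≤ 3 := by
    rintro ⟨e, b⟩
    rw [← SimpleGraph.card_neighborFinset_eq_degree]
    cases b
    · obtain ⟨a, b, hab⟩ := NetworkArrow.exists_in ρ σ e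
      refine (Finset.card_le_card (t := {(e, true), (a, true), (b, true)}) ?_).trans
        Finset.card_le_three
      rintro ⟨e', c⟩ h
      rw [SimpleGraph.mem_neighborFinset, doubleCover_adj_false] at h
      obtain ⟨rfl, rfl | h⟩ := h
      · simp
      · rcases hab _ h with rfl | rfl <;> simp
    · obtain ⟨a, b, hab⟩ := NetworkArrow.exists_out ρ σ e
      refine (Finset.card_le_card (t := {(e, false), (a, false), (b, false)}) ?_).trans
        Finset.card_le_three
      rintro ⟨e', c⟩ h
      rw [SimpleGraph.mem_neighborFinset, doubleCover_adj_true] at h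
      obtain ⟨rfl, rfl | h⟩ := h
      · simp
      · rcases hab _ h with rfl | rfl <;> simp
  obtain ⟨y⟩ := ‹Nonempty Y›
  have hge : 2 < (network ρ σ l).degree ((y, 0, ⟨l - 1, by omega⟩), true) := by
    rw [← SimpleGraph.card_neighborFinset_eq_degree, Finset.two_lt_card]
    simp only [SimpleGraph.mem_neighborFinset, doubleCover_adj_true]
    refine ⟨((y, 0, ⟨l - 1, by omega⟩), false), ⟨rfl, Or.inl rfl⟩, ((y, 1, 0), false),
      ⟨rfl, Or.inr (Or.inr ⟨?_, ?_, ?_⟩)⟩, ((y, 2, 0), false),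
      ⟨rfl, Or.inr (Or.inr ⟨?_, ?_, ?_⟩)⟩, ?_, ?_, ?_⟩ <;> simp
    all_goals omega
  have h1 := (network ρ σ l).degree_le_maxDegree ((y, 0, ⟨l - 1, by omega⟩), true)
  have h2 := (network ρ σ l).maxDegree_le_of_forall_degree_le 3 hle
  convert le_antisymm h2 (by omega)

end Network

/-! ### The bottleneck of the network and the choice of fugacity. -/

section SlowMixing

/-- A set of vertices `U` and an occupancy `k` of it which independent sets of size `N` can have
from either side, but cannot have exactly, not even up to one vertex or `w` vertices of the size. -/
def HasBottleneck {V : Type*} [Fintype V] (G : SimpleGraph V) (N w : ℕ) : Prop :=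
  ∃ (U : Set V) (k : ℕ),
    (∀ I : IndepSets G, occupancy U I = k ∨ occupancy U I = k + 1 → I.1.card + w ≤ N) ∧
    (∃ I : IndepSets G, occupancy U I ≤ k ∧ I.1.card = N) ∧
    (∃ I : IndepSets G, k < occupancy U I ∧ I.1.card = N)

theorem exists_map_indepSet {V V' : Type*} [Fintype V] [Fintype V'] {G : SimpleGraph V}
    {G' : SimpleGraph V'} (φ : G ≃g G') (I : IndepSets G) (U : Set V) :
    ∃ I' : IndepSets G', occupancy (φ '' U) I' = occupancy U I ∧ I'.1.card = I.1.card := by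
  have hcoe : ((I.1.map φ.toEquiv.toEmbedding : Finset V') : Set V') = φ '' I.1 := by
    simp
  refine ⟨⟨I.1.map φ.toEquiv.toEmbedding, ?_⟩, ?_, Finset.card_map _⟩
  · rw [hcoe]
    rintro _ ⟨a, ha, rfl⟩ _ ⟨b, hb, rfl⟩ hab h
    exact I.2 ha hb (fun h' => hab (by rw [h'])) (φ.map_adj_iff.1 h)
  · rw [occupancy, occupancy, hcoe, ← Set.image_inter φ.injective,
      Set.ncard_image_of_injective _ φ.injective]

theorem HasBottleneck.iso {V V' : Type*} [Fintype V] [Fintype V'] {G : SimpleGraph V}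
    {G' : SimpleGraph V'} {N w : ℕ} (h : HasBottleneck G N w) (φ : G ≃g G') :
    HasBottleneck G' N w := by
  obtain ⟨U, k, h1, ⟨I, hI, hI'⟩, ⟨J, hJ, hJ'⟩⟩ := h
  refine ⟨φ '' U, k, fun K hK => ?_, ?_, ?_⟩
  · obtain ⟨K', hK', hc⟩ := exists_map_indepSet φ.symm K (φ '' U)
    have : φ.symm '' (φ '' U) = U := by
      have h : φ.symm ∘ φ = id := funext φ.symm_apply_apply
      rw [← Set.image_comp, h, Set.image_id]
    rw [this] at hK'
    rw [← hc]
    exact h1 K' (by rwa [hK'])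
  · obtain ⟨K, hK, hc⟩ := exists_map_indepSet φ I U
    exact ⟨K, by rwa [hK], by rw [hc, hI']⟩
  · obtain ⟨K, hK, hc⟩ := exists_map_indepSet φ J U
    exact ⟨K, by rwa [hK], by rw [hc, hJ']⟩

variable {Y : Type*} [Fintype Y] {l : ℕ} [NeZero l] {ρ σ : Equiv.Perm Y}

theorem occupied_of_start (I : IndepSets (network ρ σ l)) {y : Y}
    (hy : ∀ s j, (y, s, j) ∉ vacantNodes I) (h0 : ((y, 0, 0), true) ∈ I.1) (s : Fin 3)
    (j : Fin l) : ((y, s, j), true) ∈ I.1 := by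
  have hl := NeZero.pos l
  have along : ∀ s : Fin 3, ((y, s, 0), true) ∈ I.1 → ∀ j : ℕ, ∀ hj : j < l,
      ((y, s, ⟨j, hj⟩), true) ∈ I.1 := by
    intro s hs j
    induction j with
    | zero => exact fun _ => hs
    | succ j ih =>
      exact fun hj => occupied_of_arrow I (e := (y, s, ⟨j, by omega⟩)) (Or.inl ⟨rfl, rfl, rfl⟩)
        (ih (by omega)) (hy _ _)
  have hstart : ((y, s, 0), true) ∈ I.1 := by
    by_cases hs : s = 0
    · rw [hs]; exact h0
    · refine occupied_of_arrow I (e := (y, 0, ⟨l - 1, by omega⟩)) (Or.inr ⟨?_, ?_, Or.inl ⟨rfl, hs, rfl⟩⟩)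
        (along 0 h0 (l - 1) (by omega)) (hy _ _)
      · simp only; omega
      · simp
  exact along s hstart j j.2

/-- Occupation spreads through all three paths of `y` and passes to `z` from the end of path `1`
(via `ρ`) or path `2` (via `σ`). -/
theorem occupied_start_of_perm (I : IndepSets (network ρ σ l)) {y z : Y}
    (hy : ∀ s j, (y, s, j) ∉ vacantNodes I) (hz : ∀ s j, (z, s, j) ∉ vacantNodes I)
    (hyz : ρ y = z ∨ σ y = z) (h0 : ((y, 0, 0), true) ∈ I.1) : ((z, 0, 0), true) ∈ I.1 := by
  have hl := NeZero.pos l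
  rcases hyz with rfl | rfl
  · refine occupied_of_arrow I (e := (y, 1, ⟨l - 1, by omega⟩))
      (Or.inr ⟨?_, ?_, Or.inr (Or.inl ⟨rfl, rfl, rfl⟩)⟩)
      (occupied_of_start I hy h0 1 ⟨l - 1, by omega⟩) (hz _ _)
    · simp only; omega
    · simp
  · refine occupied_of_arrow I (e := (y, 2, ⟨l - 1, by omega⟩))
      (Or.inr ⟨?_, ?_, Or.inr (Or.inr ⟨rfl, rfl, rfl⟩)⟩)
      (occupied_of_start I hy h0 2 ⟨l - 1, by omega⟩) (hz _ _)
    · simp only; omega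
    · simp

/-- The starting vertices of the network. -/
def networkStarts (Y : Type*) (l : ℕ) [NeZero l] : Set ((Y × Fin 3 × Fin l) × Bool) :=
  Set.range fun y => ((y, 0, 0), true)

open Classical in
theorem occupancy_networkStarts (I : IndepSets (network ρ σ l)) :
    occupancy (networkStarts Y l) I
      = (Finset.univ.filter fun y => ((y, 0, 0), true) ∈ I.1).card := by
  have hinj : Function.Injective fun y : Y => (((y, 0, 0), true) : (Y × Fin 3 × Fin l) × Bool) :=
    fun y y' h => by simpa using h
  have : ((I.1 : Set _) ∩ networkStarts Y l)
      = (((Finset.univ.filter fun y => ((y, 0, 0), true) ∈ I.1).image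
        fun y : Y => (((y, 0, 0), true) : (Y × Fin 3 × Fin l) × Bool) : Finset _) : Set _) := by
    ext x
    simp only [networkStarts, Set.mem_inter_iff, Finset.mem_coe, Set.mem_range, Finset.mem_image,
      Finset.mem_filter, Finset.mem_univ, true_and]
    constructor
    · rintro ⟨hx, y, rfl⟩
      exact ⟨y, hx, rfl⟩
    · rintro ⟨y, hx, rfl⟩
      exact ⟨hx, y, rfl⟩
  rw [occupancy, this, Set.ncard_coe_finset, Finset.card_image_of_injective _ hinj]

/-- With fewer than `w` vacancies, discard the `y` that carry one. If about half of the starts are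
occupied, expansion joins a remaining occupied start to a remaining unoccupied one, against
propagation. -/
theorem network_hasBottleneck {w : ℕ} (hw : 0 < w) (hY : Fintype.card Y = 82 * w)
    (hexp : ∀ S T : Finset Y, S.card = 40 * w → T.card = 40 * w → Disjoint S T →
      ∃ y ∈ S, ρ y ∈ T ∨ σ y ∈ T) :
    HasBottleneck (network ρ σ l) (Fintype.card (Y × Fin 3 × Fin l)) w := by
  classical
  refine ⟨networkStarts Y l, 41 * w, fun I hI => ?_, ?_, ?_⟩
  · rw [← card_add_card_vacantNodes I]
    refine Nat.add_le_add_left ?_ _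
    by_contra! hlt
    rw [occupancy_networkStarts] at hI
    set L : Finset Y := Finset.univ.filter fun y => ((y, 0, 0), true) ∈ I.1 with hL
    set B : Finset Y := (vacantNodes I).image Prod.fst with hB
    have hBw : B.card < w := Finset.card_image_le.trans_lt hlt
    have hgood : ∀ y, y ∉ B → ∀ s j, (y, s, j) ∉ vacantNodes I :=
      fun y hy s j h => hy (Finset.mem_image_of_mem Prod.fst h)
    have hS : 40 * w ≤ (L \ B).card := by
      have := Finset.le_card_sdiff B L
      omega
    -- This is tight: occupancy `41 * w + 1` leaves `41 * w - 1` starts unoccupied, of which at most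
    -- `w - 1` are discarded.
    have hT : 40 * w ≤ (Lᶜ \ B).card := by
      have := Finset.le_card_sdiff B Lᶜ
      rw [Finset.card_compl, hY] at this
      omega
    obtain ⟨S, hSL, hSc⟩ := Finset.exists_subset_card_eq hS
    obtain ⟨T, hTL, hTc⟩ := Finset.exists_subset_card_eq hT
    have hdisj : Disjoint S T := by
      rw [Finset.disjoint_left]
      intro y hyS hyT
      have h1 := (Finset.mem_sdiff.1 (hSL hyS)).1
      have h2 := (Finset.mem_sdiff.1 (hTL hyT)).1
      exact Finset.mem_compl.1 h2 h1
    have hcross : ∀ y ∈ S, ∀ z ∈ T, ¬ (ρ y = z ∨ σ y = z) := by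
      intro y hyS z hzT hyz
      have h1 := Finset.mem_sdiff.1 (hSL hyS)
      have h2 := Finset.mem_sdiff.1 (hTL hzT)
      refine Finset.mem_compl.1 h2.1 ?_
      rw [hL, Finset.mem_filter] at h1 ⊢
      exact ⟨Finset.mem_univ _,
        occupied_start_of_perm I (hgood y h1.2) (hgood z h2.2) hyz h1.1.2⟩
    obtain ⟨y, hy, h | h⟩ := hexp S T hSc hTc hdisj
    · exact hcross y hy _ h (Or.inl rfl)
    · exact hcross y hy _ h (Or.inr rfl)
  · obtain ⟨I, hI, hc⟩ := exists_indepSet_side (NetworkArrow (l := l) ρ σ) false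
    exact ⟨I, by rw [occupancy_networkStarts]; simp [hI], hc⟩
  · obtain ⟨I, hI, hc⟩ := exists_indepSet_side (NetworkArrow (l := l) ρ σ) true
    refine ⟨I, ?_, hc⟩
    rw [occupancy_networkStarts]
    simp only [hI, Finset.filter_true, Finset.card_univ, hY]
    omega

open Classical in
theorem IsLevelling.isInducedFree {V W : Type*} [Fintype V] [Fintype W] {G : SimpleGraph V}
    {H : SimpleGraph W} {l : ℕ} {h : V → ZMod (4 * l)} (hh : IsLevelling G l h)
    (hl : Fintype.card W < l) (hG : HasMaxDegree G 3) (hc : H.Connected)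
    (hclaw : ¬ IsSubdividedClaw H) (hpath : ¬ IsPathGraph H) : IsInducedFree H G := by
  rintro ⟨f⟩
  refine ((hh.comap f).isSubdividedClaw_or_isPathGraph hl hc fun v => ?_).elim hclaw hpath
  rw [← hG]
  exact (f.toCopy.degree_le v).trans (G.degree_le_maxDegree _)

/-- Graphs with all the required properties, of every size which is a multiple of `492 * l`. -/
theorem exists_bottleneck_graph (l w : ℕ) (hl : 2 ≤ l) (hw : 0 < w) :
    ∃ G : SimpleGraph (Fin (492 * l * w)), HasMaxDegree G 3 ∧ (∃ h, IsLevelling G l h) ∧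
      HasBottleneck G (246 * l * w) w := by
  classical
  have : NeZero l := ⟨by omega⟩
  have : Nonempty (Fin (82 * w)) := ⟨⟨0, by omega⟩⟩
  have hC := choose_pow_three_lt (u := 2 * w) (by omega)
  rw [show 41 * (2 * w) = 82 * w by ring, show 20 * (2 * w) = 40 * w by ring] at hC
  obtain ⟨ρ, σ, hexp⟩ := exists_expanding_perms (Fintype.card_fin (82 * w)) hC
  have hcard : Fintype.card ((Fin (82 * w) × Fin 3 × Fin l) × Bool) = 492 * l * w := by
    simp only [Fintype.card_prod, Fintype.card_fin, Fintype.card_bool]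
    ring
  have φ : network ρ σ l ≃g (network ρ σ l).overFin hcard := (network ρ σ l).overFinIso hcard
  refine ⟨_, ?_, ⟨_, (network_isLevelling ρ σ l).comap φ.symm.toEmbedding⟩, ?_⟩
  · have := network_hasMaxDegree hl ρ σ
    unfold HasMaxDegree at this ⊢
    rw [← φ.maxDegree_eq, this]
  · have := (network_hasBottleneck (l := l) hw (Fintype.card_fin _) hexp).iso φ
    rwa [show Fintype.card (Fin (82 * w) × Fin 3 × Fin l) = 246 * l * w by
      simp only [Fintype.card_prod, Fintype.card_fin]; ring] at this

/-- At this fugacity, `lam ^ w = 2 ^ n * 2 ^ (3 * w)` with `n = 492 * l * w`: the first factor pays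
for the number of states, and the second leaves `2 ^ (3 * w) / 4 ≥ 2 ^ w`. -/
theorem HasBottleneck.two_pow_le_mixingTime {l w : ℕ} (hl : 0 < l) (hw : 0 < w)
    {G : SimpleGraph (Fin (492 * l * w))} {N : ℕ} (h : HasBottleneck G N w) :
    (2 : ℝ) ^ w ≤ mixingTime G (2 ^ (492 * l + 3)) := by
  have : Nonempty (Fin (492 * l * w)) := ⟨⟨0, by positivity⟩⟩
  obtain ⟨U, k, hb, hlo, hhi⟩ := h
  have h1 := pow_le_mixingTime (one_le_pow₀ (one_le_two (α := ℝ)) (n := 492 * l + 3)) U hb hlo hhi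
  rw [Fintype.card_fin, ← pow_mul, add_mul, pow_add, mul_comm, ← mul_assoc] at h1
  have h2 := le_of_mul_le_mul_right h1 (by positivity)
  have h3 : (4 : ℝ) * 2 ^ w ≤ 2 ^ (3 * w) := by
    rw [show (4 : ℝ) = 2 ^ 2 by norm_num, ← pow_add]
    exact pow_le_pow_right₀ one_le_two (by omega)
  linarith

end SlowMixing

theorem mainTheorem3 {W : Type*} [Fintype W] (H : SimpleGraph W) (hconn : H.Connected)
    (hclaw : ¬ IsSubdividedClaw H) (hpath : ¬ IsPathGraph H) :
    ∃ lam : ℝ, 0 < lam ∧ ∃ 𝒢 : Set FiniteGraph, 𝒢.Infinite ∧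
      (∀ G ∈ 𝒢, IsInducedFree H G.2 ∧ HasMaxDegree G.2 3) ∧
      HasExponentialMixingTime lam 𝒢 := by
  -- The stretching length depends on `H` only, so the fugacity and the rate are constant along the
  -- family.
  obtain ⟨l, hl, hl2⟩ : ∃ l, Fintype.card W < l ∧ 2 ≤ l :=
    ⟨Fintype.card W + 2, by omega, by omega⟩
  have hl0 : 0 < l := by omega
  choose G hdeg hlev hbot using fun w : ℕ => exists_bottleneck_graph l (w + 1) hl2 w.succ_pos
  refine ⟨2 ^ (492 * l + 3), by positivity,
    Set.range fun w => (⟨492 * l * (w + 1), G w⟩ : FiniteGraph), ?_, ?_, ?_⟩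
  · refine Set.infinite_range_of_injective fun w w' h => ?_
    have h1 : 492 * l * (w + 1) = 492 * l * (w' + 1) := congrArg Sigma.fst h
    have := Nat.eq_of_mul_eq_mul_left (by omega) h1
    omega
  · rintro _ ⟨w, rfl⟩
    obtain ⟨h, hh⟩ := hlev w
    exact ⟨hh.isInducedFree hl (hdeg w) hconn hclaw hpath, hdeg w⟩
  -- This rate makes `exp (c * n)` equal to `2 ^ (w + 1)` on a graph with `n = 492 * l * (w + 1)`
  -- vertices.
  · refine ⟨Real.log 2 / (492 * l), by have := Real.log_pos one_lt_two; positivity, ?_⟩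
    rintro _ ⟨w, rfl⟩
    refine le_trans (le_of_eq ?_) ((hbot w).two_pow_le_mixingTime hl0 w.succ_pos)
    have h1 : Real.log 2 / (492 * l) * ((492 * l * (w + 1) : ℕ) : ℝ)
        = ((w + 1 : ℕ) : ℝ) * Real.log 2 := by
      push_cast
      field_simp
    rw [h1, Real.exp_nat_mul, Real.exp_log two_pos]
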